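/- **Setting.** Let $m\ge 1$ be an integer, $L>0$, and let $v>0$ (and $w>0$ in the Moore–Read case) be fixed entanglement velocities. The torus is cut into four consecutive cylinders $X_1,X_2,X_3,X_4$ (indices mod 4); interface $i$ joins the right edge of $X_{i-1}$ to the left edge of $X_i$. An edge has orthonormal basis vectors $|\mathcal N\rangle$, where * (Laughlin, $\nu=1/m$) $\mathcal N=(N,\{n_k\})$ consists of a winding number $N\in\mathbb Q$ and finitely many non-zero boson occupation numbers $n_k\in\mathbb Z_{\ge0}$, $k\in\frac{2\pi}{L}\mathbb Z_{>0}$, and $\lambda(\mathcal N)=\exp\!\big[-\frac{\pi v m}{2L}N^2-\sum_k\frac{vk}{2}n_k\big]$; * (Moore–Read, $\nu=1/m$) $\mathcal N=(t,N,\{n_k\},\{\tilde n_k\})$ has in addition a boundary condition $t$ (untwisted/twisted) and fermion occupation numbers $\tilde n_k\in\{0,1\}$, finitely many non-zero, with $k\in\frac{2\pi}{L}(\mathbb Z_{\ge0}+\frac12)$ if untwisted and $k\in\frac{2\pi}{L}\mathbb Z_{>0}$ if twisted, and $\lambda(\mathcal N)=\exp\!\big[-\frac{\pi v m}{2L}N^2-\sum_k\frac{vk}{2}n_k-\sum_k\frac{wk}{2}\tilde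 n_k\big]$. A cylinder has basis vectors $|\mathcal N^{\rm left},\mathcal N^{\rm right}\rangle$, and in the Moore–Read case $|\mathcal N^{\rm left},\mathcal N^{\rm right},\gamma\rangle$ with $\gamma\in\{0,1\}$. *Laughlin sectors* $a\in\{0,\dots,m-1\}$, with $d_a=1$: $$|\Psi_a\rangle=\sum_{\mathcal N_1,\dots,\mathcal N_4}\ \prod_{i=1}^4\lambda(\mathcal N_i)\ \bigotimes_{i=1}^4|\mathcal N_i,\mathcal N_{i+1}\rangle_{X_i},\qquad N_i\in\mathbb Z-\tfrac am .$$ *Moore–Read sectors*: $I^r$, $\chi^r$ (untwisted, $d_a=1$) and $\xi^{r+1/2}$ (twisted, $d_a=\sqrt2$), $r=0,\dots,m-1$. Put $q_a=r$, $r+m$, $r+\frac12$ respectively. Then $$|\Psi_a\rangle=\sum_{\mathcal N_1,\dots,\mathcal N_4}\sum_{\gamma_1,\dots,\gamma_4}f_a(\gamma)\prod_{i=1}^4P_{a,i}\; i^{\sum_k\tilde n_{i,k}}\lambda(\mathcal N_i)\ \bigotimes_{i=1}^4|\mathcal N_i,\mathcal N_{i+1},\gamma_i\rangle_{X_i},\qquad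 N_i\in\mathbb Z+\tfrac{q_a}{m},$$ the boundary condition of every $\mathcal N_i$ being that of $a$. If $a$ is untwisted, $f_a(\gamma)=1$ for $\gamma=0$ and $0$ otherwise, and $P_{a,i}$ is the product, over the two edges $\mathcal N\in\{\mathcal N_i,\mathcal N_{i+1}\}$ of $X_i$, of $\frac12\big(1+(-1)^{N-q_a/m+\sum_k\tilde n_k}\big)$. If $a$ is twisted, $f_a(\gamma)=2^{-3/2}$ if $\sum_i\gamma_i$ is odd and $0$ otherwise, and $P_{a,i}=\frac12\big(1+(-1)^{N_{i+1}-N_i+\sum_k(\tilde n_{i,k}+\tilde n_{i+1,k})+\gamma_i+\delta_{i,4}}\big)$. The torus state with amplitudes $\psi_a\in\mathbb C$, $\sum_a|\psi_a|^2=1$, is $|\Psi\rangle=\sum_a\psi_a|\Psi_a\rangle/\|\Psi_a\|$. For a density matrix $\rho$ on $\mathcal H_A\otimes\mathcal H_B$ let $\mathcal E_{A:B}(\rho)=\log\|\rho^{T_A}\|_1$, where $T_A$ is the partial transpose in the above basis and $\|T\|_1=\operatorname{tr}\sqrt{T^\dagger T}$. A state $\rho_{ABC}$ satisfies the *disentangling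 condition* if $\mathcal E_{A:BC}(\rho_{ABC})=\mathcal E_{A:B}(\rho_{AB})$, $\rho_{AB}=\operatorname{tr}_C\rho_{ABC}$. **Theorem.** For Laughlin and for Moore–Read torus states, all negativities below are finite for every $L>0$, and: 1. ($AB_1CB_2$ geometry: $A=X_1$, $B=X_2\cup X_4$, $C=X_3$, $\rho_{ABC}=|\Psi\rangle\langle\Psi|$.) For fixed $\psi$, $$\lim_{L\to\infty}\big[\mathcal E_{A:BC}(\rho_{ABC})-\mathcal E_{A:B}(\rho_{AB})\big]=\log\frac{\big(\sum_a|\psi_a|d_a\big)^2}{\sum_a|\psi_a|^2d_a^2}.$$ 2. In this geometry the disentangling condition holds if and only if the torus state lies in a single topological sector, i.e. $|\psi_a|=1$ for one $a$ and $\psi_b=0$ for all $b\ne a$. This is true both for the condition at each fixed $L>0$ and for the condition in the limit, i.e. that the limit in 1 be $0$. 3. ($ABCD$ geometry: $A=X_1$, $B=X_2$, $C=X_3$, $D=X_4$, $\rho_{ABC}=\operatorname{tr}_D|\Psi\rangle\langle\Psi|$.) The disentangling condition holds for every $L>0$ and every $\psi$. -/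

import Mathlib

open scoped ENNReal

noncomputable section

/-! ### Infinite matrices, trace norm, partial trace and partial transpose

A quantum system with a countable orthonormal basis labelled by `ι` has the Hilbert space
`ℓ²(ι, ℂ)`; operators are described by their matrix elements `⟨i|ρ|j⟩ = ρ i j`. -/

/-- The trace norm `‖T‖₁ = tr √(T† T)` of a bounded operator on a Hilbert space with orthonormal
basis `b`, with values in `[0, ∞]`. -/
def opTraceNorm {ι H : Type} [NormedAddCommGroup H] [InnerProductSpace ℂ H] [CompleteSpace H]
    (b : HilbertBasis ι ℂ H) (T : H →L[ℂ] H) : ℝ≥0∞ :=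
  ∑' i : ι, ENNReal.ofReal (RCLike.re (inner ℂ (b i) (CFC.sqrt (star T * T) (b i))))

/-- `T` is the bounded operator with matrix elements `⟨i|T|j⟩ = K i j` in the basis `b`. -/
def HasMatrix {ι H : Type} [NormedAddCommGroup H] [InnerProductSpace ℂ H]
    (b : HilbertBasis ι ℂ H) (T : H →L[ℂ] H) (K : Matrix ι ι ℂ) : Prop :=
  ∀ i j : ι, inner ℂ (b i) (T (b j)) = K i j

/-- The Hilbert space with orthonormal basis labelled by `ι`. -/
abbrev HilbertOf (ι : Type) : Type := lp (fun _ : ι => ℂ) 2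

/-- The standard basis of `ℓ²(ι, ℂ)`. -/
def stdBasis (ι : Type) : HilbertBasis ι ℂ (HilbertOf ι) :=
  HilbertBasis.ofRepr (LinearIsometryEquiv.refl ℂ (HilbertOf ι))

/-- The trace norm of an infinite matrix: that of the (unique) bounded operator with this matrix,
and `∞` if the matrix does not define a bounded operator. -/
def traceNorm {ι : Type} (K : Matrix ι ι ℂ) : ℝ≥0∞ :=
  ⨅ (T : HilbertOf ι →L[ℂ] HilbertOf ι) (_ : HasMatrix (stdBasis ι) T K),
    opTraceNorm (stdBasis ι) T

/-- The density matrix `|Ψ⟩⟨Ψ|`. -/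
def pureDensity {ι : Type} (Ψ : ι → ℂ) : Matrix ι ι ℂ :=
  fun x y => Ψ x * starRingEnd ℂ (Ψ y)

/-- Partial trace over the second factor. -/
def traceSnd {α β : Type} (ρ : Matrix (α × β) (α × β) ℂ) : Matrix α α ℂ :=
  fun x y => ∑' b : β, ρ (x, b) (y, b)

/-- Partial transpose on the first factor: `⟨i j|ρ^{T_A}|k l⟩ = ⟨k j|ρ|i l⟩`. -/
def partialTranspose {α β : Type} (ρ : Matrix (α × β) (α × β) ℂ) :
    Matrix (α × β) (α × β) ℂ :=
  fun x y => ρ (y.1, x.2) (x.1, y.2)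

/-- Entanglement (logarithmic) negativity `E_{A:B}(ρ) = log ‖ρ^{T_A}‖₁`. -/
def logNeg {α β : Type} (ρ : Matrix (α × β) (α × β) ℂ) : EReal :=
  ENNReal.log (traceNorm (partialTranspose ρ))

/-- `ρ_{AB} = tr_C ρ_{ABC}`. -/
def reduceAB {α β γ : Type} (ρ : Matrix (α × β × γ) (α × β × γ) ℂ) :
    Matrix (α × β) (α × β) ℂ :=
  traceSnd (ρ.submatrix (Equiv.prodAssoc α β γ) (Equiv.prodAssoc α β γ))

/-- The disentangling condition `E_{A:BC}(ρ) = E_{A:B}(ρ_{AB})`. -/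
def DisentanglingCondition {α β γ : Type} (ρ : Matrix (α × β × γ) (α × β × γ) ℂ) : Prop :=
  logNeg ρ = logNeg (reduceAB ρ)

/-! ### Four cylinders glued into a torus

`K` labels the basis states of one cylinder; the cylinders `X₁, X₂, X₃, X₄` are indexed by
`0, 1, 2, 3 : Fin 4`, cyclically. -/

/-- `∑_a ψ_a |Ψ_a⟩ / ‖Ψ_a‖`, from the unnormalized sector states `|Ψ_a⟩`. -/
def torusState {S K : Type} [Fintype S] (Φ : S → (Fin 4 → K) → ℂ) (ψ : S → ℂ)
    (x : Fin 4 → K) : ℂ :=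
  ∑ a, ψ a * (Φ a x / ((Real.sqrt (∑' y : Fin 4 → K, ‖Φ a y‖ ^ 2) : ℝ) : ℂ))

/-- `ρ_{ABC}` when the four consecutive cylinders are `A, B₁, C, B₂` and `B = B₁ ∪ B₂`. -/
def rhoAB1CB2 {K : Type} (Ψ : (Fin 4 → K) → ℂ) :
    Matrix (K × (K × K) × K) (K × (K × K) × K) ℂ :=
  pureDensity fun s => Ψ ![s.1, s.2.1.1, s.2.2, s.2.1.2]

/-- `ρ_{ABC} = tr_D |Ψ⟩⟨Ψ|` when the four consecutive cylinders are `A, B, C, D`. -/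
def rhoABCD {K : Type} (Ψ : (Fin 4 → K) → ℂ) : Matrix (K × K × K) (K × K × K) ℂ :=
  traceSnd (pureDensity fun s : (K × K × K) × K => Ψ ![s.1.1, s.1.2.1, s.1.2.2, s.2])

/-- The state with amplitudes `ψ` lies in a single topological sector. -/
def InSingleSector {S : Type} (ψ : S → ℂ) : Prop :=
  ∃ a, ‖ψ a‖ = 1 ∧ ∀ b, b ≠ a → ψ b = 0

/-! ### Laughlin states at filling `1/m`

`v` is the entanglement velocity and `L` the circumference of the interfaces. The divergent
zero-point factor, common to all basis states of a sector, is omitted from the weights: it cancels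
in the normalized states. -/

/-- Collective mode numbers of an edge: the winding number `N` and the occupation numbers of the
boson modes; the mode `j` has momentum `2π(j+1)/L`. -/
structure LaughlinEdge : Type where
  winding : ℚ
  boson : ℕ →₀ ℕ

/-- Basis states of a cylinder: mode numbers of its left and right edges. -/
structure LaughlinCyl : Type where
  left : LaughlinEdge
  right : LaughlinEdge

/-- The weight
`λ(N, n) = exp(-(π v m / 2L) N² - ∑_k (v k / 2) n_k)`. -/
def laughlinWeight (m : ℕ) (v L : ℝ) (e : LaughlinEdge) : ℝ :=
  Real.exp (-(v * Real.pi * m / (2 * L)) * (e.winding : ℝ) ^ 2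
    - e.boson.sum fun j n => v * (2 * Real.pi * ((j : ℝ) + 1) / L) / 2 * n)

open Classical in
/-- Amplitude of `|e⟩ ⊗ |e⟩` in the ground state of one interface in sector `a`, where the winding
numbers range over `ℤ - a/m`. -/
def laughlinInterface (m : ℕ) (v L : ℝ) (a : Fin m) (e : LaughlinEdge) : ℂ :=
  if ∃ n : ℤ, e.winding = (n : ℚ) - (a : ℕ) / (m : ℚ) then (laughlinWeight m v L e : ℂ) else 0

open Classical in
/-- The unnormalized torus ground state in sector `a`: the product over the four interfaces of the
interface ground states, where interface `i` joins the right edge of one cylinder to the left edge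
of the next cylinder `i`. -/
def laughlinSectorState (m : ℕ) (v L : ℝ) (a : Fin m) (x : Fin 4 → LaughlinCyl) : ℂ :=
  if ∀ i, (x i).right = (x (i + 1)).left then ∏ i, laughlinInterface m v L a (x i).left else 0

/-- The Laughlin torus state with sector amplitudes `ψ`. -/
def laughlinState (m : ℕ) (v L : ℝ) (ψ : Fin m → ℂ) : (Fin 4 → LaughlinCyl) → ℂ :=
  torusState (laughlinSectorState m v L) ψ

/-- All Laughlin anyons are Abelian. -/
def laughlinDim (m : ℕ) (_a : Fin m) : ℝ := 1

/-! ### Moore-Read states at filling `1/m`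

`v` and `w` are the entanglement velocities of the boson and of the Majorana fermion. -/

/-- The `3m` anyon types `I^r`, `χ^r` (untwisted) and `ξ^{r+1/2}` (twisted). -/
abbrev MRSector (m : ℕ) : Type := (Fin m ⊕ Fin m) ⊕ Fin m

/-- The label `r` of the vertex operator `e^{irφ}`: `r` for `I^r`, `r + m` for `χ^r ≡ I^{r+m}` and
`r + 1/2` for `ξ^{r+1/2}`. -/
def mrCharge (m : ℕ) : MRSector m → ℚ
  | Sum.inl (Sum.inl r) => (r : ℕ)
  | Sum.inl (Sum.inr r) => (r : ℕ) + (m : ℚ)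
  | Sum.inr r => (r : ℕ) + 1 / 2

/-- Whether the sector is twisted. -/
def mrTwisted (m : ℕ) : MRSector m → Bool
  | Sum.inl _ => false
  | Sum.inr _ => true

/-- Quantum dimensions: `1` for `I^r` and `χ^r`, `√2` for `ξ^{r+1/2}`. -/
def mrDim (m : ℕ) : MRSector m → ℝ
  | Sum.inl _ => 1
  | Sum.inr _ => Real.sqrt 2

/-- Collective mode numbers of an edge: the boundary condition of the Majorana fermion
(`twisted = true` if periodic), the winding number, the boson occupation numbers (mode `j` has
momentum `2π(j+1)/L`), and the set of occupied fermion modes (mode `j` has momentum `2π(j+1/2)/L`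
in the untwisted and `2π(j+1)/L` in the twisted case). -/
structure MREdge : Type where
  twisted : Bool
  winding : ℚ
  boson : ℕ →₀ ℕ
  fermion : Finset ℕ

/-- Basis states of a cylinder: mode numbers of its left and right edges and the occupation number
`γ` of the Majorana zero modes of the cylinder, which is `0` when there are none. -/
structure MRCyl : Type where
  left : MREdge
  right : MREdge
  zero : Fin 2

/-- Momentum of the fermion mode `j`. -/
def mrFermionMomentum (L : ℝ) (twisted : Bool) (j : ℕ) : ℝ :=
  2 * Real.pi * ((j : ℝ) + if twisted then 1 else 1 / 2) / L

/-- The weight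
`λ(N, n, ñ) = exp(-(π v m / 2L) N² - ∑_k (v k / 2) n_k - ∑_k (w k / 2) ñ_k)`. -/
def mrWeight (m : ℕ) (v w L : ℝ) (e : MREdge) : ℝ :=
  Real.exp (-(v * Real.pi * m / (2 * L)) * (e.winding : ℝ) ^ 2
    - (e.boson.sum fun j n => v * (2 * Real.pi * ((j : ℝ) + 1) / L) / 2 * n)
    - ∑ j ∈ e.fermion, w * mrFermionMomentum L e.twisted j / 2)

open Classical in
/-- Amplitude of `|e⟩ ⊗ |e⟩` in the unprojected ground state of one interface in sector `a` with
label `r`, where the winding numbers range over `ℤ + r/m`. -/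
def mrInterface (m : ℕ) (v w L : ℝ) (a : MRSector m) (e : MREdge) : ℂ :=
  if e.twisted = mrTwisted m a ∧ ∃ n : ℤ, e.winding = (n : ℚ) + mrCharge m a / (m : ℚ) then
    Complex.I ^ e.fermion.card * (mrWeight m v w L e : ℂ)
  else 0

/-- Eigenvalue `(1 + (-1)^{N - r/m + ∑ ñ_k}) / 2` of the projection at an edge in an untwisted
sector. -/
def mrEdgeProj (m : ℕ) (a : MRSector m) (e : MREdge) : ℂ :=
  (1 + (-1) ^ (⌊e.winding - mrCharge m a / (m : ℚ)⌋ + (e.fermion.card : ℤ))) / 2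

/-- Eigenvalue of the projection of cylinder `i` onto states invariant under its `ℤ₂` symmetry. In
an untwisted sector it is the product of the projections at the two edges; in a twisted sector it is
`(1 + (-1)^{-N_i + N_{i+1} + ∑ ñ_{i,k} + ∑ ñ_{i+1,k} + γ_i + u_i}) / 2` with `u_i = 1` for the last
cylinder and `u_i = 0` for the others. -/
def mrCylProj (m : ℕ) (a : MRSector m) (i : Fin 4) (c : MRCyl) : ℂ :=
  if mrTwisted m a then
    (1 + (-1) ^ (⌊c.right.winding - c.left.winding⌋ + (c.left.fermion.card : ℤ)
      + (c.right.fermion.card : ℤ) + ((c.zero : ℕ) : ℤ) + (if i = 3 then 1 else 0))) / 2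
  else mrEdgeProj m a c.left * mrEdgeProj m a c.right

/-- Amplitude of the Majorana zero modes: trivial in an untwisted sector; in a twisted sector the
uniform superposition of the `2³` occupation vectors with odd total occupation. -/
def mrZeroMode (m : ℕ) (a : MRSector m) (γ : Fin 4 → Fin 2) : ℂ :=
  if mrTwisted m a then
    (if Odd (∑ i, (γ i : ℕ)) then ((1 / Real.sqrt (2 ^ 3) : ℝ) : ℂ) else 0)
  else (if ∀ i, γ i = 0 then 1 else 0)

open Classical in
/-- The unnormalized torus ground state in sector `a`: the product of the interface ground states
and the zero-mode state, projected to the `ℤ₂` invariant states of every cylinder. -/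
def mrSectorState (m : ℕ) (v w L : ℝ) (a : MRSector m) (x : Fin 4 → MRCyl) : ℂ :=
  if ∀ i, (x i).right = (x (i + 1)).left then
    (∏ i, mrCylProj m a i (x i)) * (∏ i, mrInterface m v w L a (x i).left)
      * mrZeroMode m a (fun i => (x i).zero)
  else 0

/-- The Moore-Read torus state with sector amplitudes `ψ`. -/
def mrState (m : ℕ) (v w L : ℝ) (ψ : MRSector m → ℂ) : (Fin 4 → MRCyl) → ℂ :=
  torusState (mrSectorState m v w L) ψ

end

open scoped ENNReal NNReal ComplexConjugate

noncomputable section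

/-! ### Trace norms from singular value decompositions -/

/-! A sector state is a product of four interface vectors `∑ w_a(e) |e⟩|e⟩`, and on its support
every cylinder state is determined by the mode numbers of its two edges. In a twisted Moore-Read
sector the projections fix the zero modes as well. A single edge with nonzero weight determines the
sector, so every sum over sectors has at most one nonzero term. `GluedTorus` abstracts this
situation.

Each density matrix is then a mixture of pure vectors whose rows have suitably disjoint supports,
and its partial transpose has an explicit singular value decomposition.
`traceNorm_partialTranspose_mixture` evaluates the trace norm as `∑_i (∑_s n_i(s))²`, with `n_i(s)`
the row norms. Put `X_a = (∑ |w_a|)² / ∑ |w_a|²`. For the pure `AB₁CB₂` state the trace norm is `(∑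
|ψ_a| X_a)²`: sectors add before squaring. Tracing out `C` measures the sector and leaves `∑ (|ψ_a|
X_a)²`. As `X_a > 0`, the two agree exactly when one sector is present. In the `ABCD` geometry both
trace norms equal `∑ |ψ_a|² X_a`, because tracing out `D` has already measured the sector.

For the limit one needs `X_a` proportional to `d_a` asymptotically. The exponents are proportional
to `1/L`, so squaring a weight halves `L`, and `X_a(L) = N_a(L)² / N_a(L/2)` with `N_a = ∑ |w_a|`.
It remains to compare the `N_a` as `L → ∞`. Boson sums are common to all sectors, and winding sums
forget their offset (`tendsto_windingSum_div`). In untwisted sectors the parity projection halves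
the sum (`tendsto_evenSum_div`). The twisted fermion sum is `1/√2` of the untwisted one
(`tendsto_fermionSum_div`). Hence the proportions are `1/2` to `1/√2`, that is `1` to `√2`. -/

theorem inner_stdBasis {ι : Type} (i : ι) (u : HilbertOf ι) :
    inner ℂ (stdBasis ι i) u = u i :=
  ((stdBasis ι).repr_apply_apply u i).symm

theorem HasMatrix.unique {ι H : Type} [NormedAddCommGroup H] [InnerProductSpace ℂ H]
    {b : HilbertBasis ι ℂ H} {T T' : H →L[ℂ] H} {K : Matrix ι ι ℂ}
    (h : HasMatrix b T K) (h' : HasMatrix b T' K) : T = T' := by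
  refine ContinuousLinearMap.ext_on
    ((Submodule.dense_iff_topologicalClosure_eq_top).2 b.dense_span) ?_
  rintro _ ⟨j, rfl⟩
  apply b.repr.injective
  ext i
  rw [b.repr_apply_apply, b.repr_apply_apply, h i j, h' i j]

/-- A bounded operator is determined by its matrix, so the infimum runs over a single operator. -/
theorem traceNorm_eq_of_hasMatrix {ι : Type} {K : Matrix ι ι ℂ}
    {T : HilbertOf ι →L[ℂ] HilbertOf ι} (h : HasMatrix (stdBasis ι) T K) :
    traceNorm K = opTraceNorm (stdBasis ι) T := by
  apply le_antisymm
  · exact iInf₂_le T h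
  · refine le_iInf₂ fun T' h' => ?_
    rw [h.unique h']

theorem re_inner_mul_symm {H : Type} [NormedAddCommGroup H] [InnerProductSpace ℂ H] (x y : H) :
    (inner ℂ x y * inner ℂ y x).re = ‖inner ℂ y x‖ ^ 2 := by
  rw [← RCLike.re_eq_complex_re, inner_mul_symm_re_eq_norm, norm_mul, norm_inner_symm, sq]

section SingularValues

variable {J H : Type} [NormedAddCommGroup H] [InnerProductSpace ℂ H] [CompleteSpace H]

/-- The operator `∑ σ_j |f_j⟩⟨g_j|`. -/
def svdOp (σ : J → ℝ) (f g : J → H) : H →L[ℂ] H :=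
  ∑' j, (σ j : ℂ) • InnerProductSpace.rankOne ℂ (f j) (g j)

variable {σ : J → ℝ} {f g : J → H}

theorem summable_svdOp (hσ0 : ∀ j, 0 ≤ σ j) (hσ : Summable σ) (hf : Orthonormal ℂ f)
    (hg : Orthonormal ℂ g) :
    Summable fun j => (σ j : ℂ) • InnerProductSpace.rankOne ℂ (f j) (g j) := by
  refine Summable.of_norm ?_
  refine hσ.congr fun j => ?_
  rw [norm_smul, InnerProductSpace.norm_rankOne, hf.1 j, hg.1 j]
  simp [abs_of_nonneg (hσ0 j)]

theorem hasSum_svdOp_apply (hσ0 : ∀ j, 0 ≤ σ j) (hσ : Summable σ) (hf : Orthonormal ℂ f)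
    (hg : Orthonormal ℂ g) (x : H) :
    HasSum (fun j => ((σ j : ℂ) * inner ℂ (g j) x) • f j) (svdOp σ f g x) := by
  have h := (summable_svdOp hσ0 hσ hf hg).hasSum
  have := h.mapL (ContinuousLinearMap.apply ℂ H x)
  simpa [svdOp, mul_smul] using this

theorem hasSum_inner_svdOp (hσ0 : ∀ j, 0 ≤ σ j) (hσ : Summable σ) (hf : Orthonormal ℂ f)
    (hg : Orthonormal ℂ g) (x y : H) :
    HasSum (fun j => (σ j : ℂ) * inner ℂ (g j) x * inner ℂ y (f j))
      (inner ℂ y (svdOp σ f g x)) := by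
  have h := (hasSum_svdOp_apply hσ0 hσ hf hg x).mapL (innerSL ℂ y)
  simpa [inner_smul_right] using h

theorem inner_svdOp (hσ0 : ∀ j, 0 ≤ σ j) (hσ : Summable σ) (hf : Orthonormal ℂ f)
    (hg : Orthonormal ℂ g) (x : H) (j : J) :
    inner ℂ (f j) (svdOp σ f g x) = (σ j : ℂ) * inner ℂ (g j) x := by
  classical
  rw [← (hasSum_inner_svdOp hσ0 hσ hf hg x (f j)).tsum_eq, tsum_eq_single j]
  · rw [orthonormal_iff_ite.1 hf j j]; simp
  · intro k hk
    rw [orthonormal_iff_ite.1 hf j k, if_neg (Ne.symm hk), mul_zero]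

theorem star_svdOp (hσ0 : ∀ j, 0 ≤ σ j) (hσ : Summable σ) (hf : Orthonormal ℂ f)
    (hg : Orthonormal ℂ g) : star (svdOp σ f g) = svdOp σ g f := by
  have h := (summable_svdOp hσ0 hσ hf hg).hasSum.star
  rw [svdOp, svdOp, ← h.tsum_eq]
  congr 1
  ext1 j
  rw [star_smul, ContinuousLinearMap.star_eq_adjoint, InnerProductSpace.adjoint_rankOne]
  simp

theorem svdOp_nonneg (hσ0 : ∀ j, 0 ≤ σ j) (hσ : Summable σ) (hg : Orthonormal ℂ g) :
    0 ≤ svdOp σ g g := by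
  rw [ContinuousLinearMap.nonneg_iff_isPositive, ContinuousLinearMap.isPositive_def']
  refine ⟨star_svdOp hσ0 hσ hg hg, fun x => ?_⟩
  rw [ContinuousLinearMap.reApplyInnerSelf_apply, inner_re_symm]
  have h := Complex.hasSum_re (hasSum_inner_svdOp hσ0 hσ hg hg x x)
  refine h.nonneg fun j => ?_
  rw [mul_assoc, Complex.re_ofReal_mul]
  refine mul_nonneg (hσ0 j) ?_
  rw [re_inner_mul_symm]
  exact sq_nonneg _

/-- Orthonormality of `f` removes `f` from `T†T`, leaving `∑ σ_j² |g_j⟩⟨g_j|`, whose positive square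
root is read off. -/
theorem sqrt_star_mul_svdOp (hσ0 : ∀ j, 0 ≤ σ j) (hσ : Summable σ) (hf : Orthonormal ℂ f)
    (hg : Orthonormal ℂ g) :
    CFC.sqrt (star (svdOp σ f g) * svdOp σ f g) = svdOp σ g g := by
  refine CFC.sqrt_unique ?_ (svdOp_nonneg hσ0 hσ hg)
  ext x
  rw [star_svdOp hσ0 hσ hf hg]
  change svdOp σ g g (svdOp σ g g x) = svdOp σ g f (svdOp σ f g x)
  rw [← (hasSum_svdOp_apply hσ0 hσ hg hg _).tsum_eq, ← (hasSum_svdOp_apply hσ0 hσ hg hf _).tsum_eq]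
  simp only [inner_svdOp hσ0 hσ hf hg, inner_svdOp hσ0 hσ hg hg]

/-- The trace becomes a double sum of nonnegative terms. Exchanging the sums in `[0, ∞]` and
applying Parseval to the unit vectors `g j` leaves the singular values. -/
theorem opTraceNorm_svdOp {ι : Type} (b : HilbertBasis ι ℂ H) (hσ0 : ∀ j, 0 ≤ σ j)
    (hσ : Summable σ) (hf : Orthonormal ℂ f) (hg : Orthonormal ℂ g) :
    opTraceNorm b (svdOp σ f g) = ∑' j, ENNReal.ofReal (σ j) := by
  rw [opTraceNorm, sqrt_star_mul_svdOp hσ0 hσ hf hg]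
  have key (i : ι) : ENNReal.ofReal (RCLike.re (inner ℂ (b i) (svdOp σ g g (b i))))
      = ∑' j, ENNReal.ofReal (σ j * ‖inner ℂ (b i) (g j)‖ ^ 2) := by
    have h := Complex.hasSum_re (hasSum_inner_svdOp hσ0 hσ hg hg (b i) (b i))
    have h2 (j : J) : ((σ j : ℂ) * inner ℂ (g j) (b i) * inner ℂ (b i) (g j)).re
        = σ j * ‖inner ℂ (b i) (g j)‖ ^ 2 := by
      rw [mul_assoc, Complex.re_ofReal_mul, re_inner_mul_symm]
    simp only [h2] at h
    rw [← ENNReal.ofReal_tsum_of_nonneg (fun j => mul_nonneg (hσ0 j) (sq_nonneg _)) h.summable,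
      h.tsum_eq]
    rfl
  simp only [key]
  rw [ENNReal.tsum_comm]
  congr 1
  ext1 j
  have h := Complex.hasSum_re (b.hasSum_inner_mul_inner (g j) (g j))
  simp only [re_inner_mul_symm, inner_self_eq_norm_sq_to_K, hg.1 j] at h
  have h3 := h.mul_left (σ j)
  rw [← ENNReal.ofReal_tsum_of_nonneg (fun i => mul_nonneg (hσ0 j) (sq_nonneg _)) h3.summable,
      h3.tsum_eq]
  simp

end SingularValues

/-- The trace norm of a matrix with a given singular value decomposition. -/
theorem traceNorm_of_svd {ι J : Type} {K : Matrix ι ι ℂ} {σ : J → ℝ} {f g : J → HilbertOf ι}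
    (hσ0 : ∀ j, 0 ≤ σ j) (hσ : Summable σ) (hf : Orthonormal ℂ f) (hg : Orthonormal ℂ g)
    (hK : ∀ x y, K x y = ∑' j, (σ j : ℂ) * f j x * conj (g j y)) :
    traceNorm K = ∑' j, ENNReal.ofReal (σ j) := by
  rw [← opTraceNorm_svdOp (stdBasis ι) hσ0 hσ hf hg]
  apply traceNorm_eq_of_hasMatrix
  intro x y
  rw [← (hasSum_inner_svdOp hσ0 hσ hf hg _ _).tsum_eq, hK]
  congr 1
  ext1 j
  rw [inner_stdBasis, ← inner_conj_symm, inner_stdBasis]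
  ring

theorem exists_orthonormal_of_disjoint {J ι : Type} (f : J → ι → ℂ)
    (h1 : ∀ j, HasSum (fun x => ‖f j x‖ ^ 2) 1)
    (h0 : ∀ j j' x, f j x ≠ 0 → f j' x ≠ 0 → j = j') :
    ∃ F : J → HilbertOf ι, Orthonormal ℂ F ∧ ∀ j x, F j x = f j x := by
  have hmem (j : J) : Memℓp (f j) 2 := by
    rw [memℓp_gen_iff (by norm_num)]
    simpa using (h1 j).summable
  refine ⟨fun j => ⟨f j, hmem j⟩, ⟨fun j => ?_, fun j j' hj => ?_⟩, fun j x => rfl⟩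
  · have h := lp.norm_rpow_eq_tsum (p := 2) (by norm_num) (⟨f j, hmem j⟩ : HilbertOf ι)
    have h2 : ‖(⟨f j, hmem j⟩ : HilbertOf ι)‖ ^ 2 = 1 := by
      have h3 := (h1 j).tsum_eq
      simpa [h3] using h
    exact (pow_eq_one_iff_of_nonneg (norm_nonneg _) two_ne_zero).1 h2
  · change inner ℂ (⟨f j, hmem j⟩ : HilbertOf ι) (⟨f j', hmem j'⟩ : HilbertOf ι) = 0
    rw [lp.inner_eq_tsum]
    convert tsum_zero with x
    by_cases hx : f j x = 0
    · simp [hx]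
    · by_cases hx' : f j' x = 0
      · simp [hx']
      · exact absurd (h0 j j' x hx hx') hj

/-- The trace norm of the partial transpose of a mixture of (unnormalized) pure states `φ i`, whose
rows `φ i s`, `s : α`, have norms `n i s` and are disjointly supported. -/
theorem traceNorm_partialTranspose_mixture {I α β : Type} (φ : I → α → β → ℂ) (n : I → α → ℝ≥0)
    (ρ : Matrix (α × β) (α × β) ℂ)
    (hρ : ∀ x y, ρ x y = ∑' i, φ i x.1 x.2 * conj (φ i y.1 y.2))
    (hn : ∀ i s, ∑' b, ‖φ i s b‖ₑ ^ 2 = (n i s : ℝ≥0∞) ^ 2)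
    (hdis : ∀ i i' s s' t b b₁ b₂, φ i s b ≠ 0 → φ i' s' b ≠ 0 → φ i t b₁ ≠ 0 → φ i' t b₂ ≠ 0 →
      i = i' ∧ s = s')
    (hfin : ∑' i, (∑' s, (n i s : ℝ≥0∞)) ^ 2 ≠ ⊤) :
    traceNorm (partialTranspose ρ) = ∑' i, (∑' s, (n i s : ℝ≥0∞)) ^ 2 := by
  classical
  have hnsum (i s) : HasSum (fun b => ‖φ i s b‖ ^ 2) ((n i s : ℝ) ^ 2) := by
    have h := hn i s
    have h1 : ∑' b, ((‖φ i s b‖₊ ^ 2 : ℝ≥0) : ℝ≥0∞) = ((n i s ^ 2 : ℝ≥0) : ℝ≥0∞) := by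
      push_cast; exact h
    have h2 : HasSum (fun b => ‖φ i s b‖₊ ^ 2) (n i s ^ 2) := by
      rw [← ENNReal.hasSum_coe, ← h1]
      exact ENNReal.summable.hasSum
    have h3 := NNReal.hasSum_coe.2 h2
    push_cast at h3
    simpa using h3
  have hz {i s} (h : n i s = 0) (b) : φ i s b = 0 := by
    have h1 := hnsum i s
    rw [h] at h1
    have h2 := (hasSum_zero_iff_of_nonneg (fun b => sq_nonneg _)).1 (by simpa using h1)
    simpa using congrFun h2 b
  have hex {i s} (h : n i s ≠ 0) : ∃ b, φ i s b ≠ 0 := by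
    by_contra! hc
    have h1 := hn i s
    simp [hc] at h1
    exact h (by simpa using h1.symm)
  -- The triple `(i, s, t)` labels the rank-one piece with left vector `|t⟩ ⊗ φ i s`, right vector
  -- `|s⟩ ⊗ φ i t` and singular value `n i s * n i t`. Triples with a vanishing singular value are
  -- discarded because their vectors cannot be normalized.
  let J : Set (I × α × α) := {p | n p.1 p.2.1 * n p.1 p.2.2 ≠ 0}
  have hunit (i : I) (s t : α) (h : n i s ≠ 0) :
      HasSum (fun x : α × β => ‖if x.1 = t then φ i s x.2 / (n i s : ℂ) else 0‖ ^ 2) 1 := by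
    have hinj : Function.Injective (fun b : β => (t, b)) := fun b b' h => (Prod.ext_iff.1 h).2
    rw [← hinj.hasSum_iff]
    · have h1 := (hnsum i s).div_const ((n i s : ℝ) ^ 2)
      rw [div_self (pow_ne_zero 2 (by exact_mod_cast h))] at h1
      refine h1.congr_fun fun b => ?_
      simp [div_pow]
    · rintro ⟨t', b⟩ hx
      have : t' ≠ t := fun h => hx ⟨b, by rw [h]⟩
      simp [this]
  obtain ⟨F, hF, hFx⟩ := exists_orthonormal_of_disjoint
    (fun (p : J) (x : α × β) =>
      if x.1 = p.1.2.2 then φ p.1.1 p.1.2.1 x.2 / (n p.1.1 p.1.2.1 : ℂ) else 0)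
    (fun p => hunit _ _ _ (left_ne_zero_of_mul p.2)) (by
      rintro ⟨⟨i, s, t⟩, hp⟩ ⟨⟨i', s', t'⟩, hp'⟩ ⟨u, b⟩ h h'
      simp only [ne_eq, ite_eq_right_iff, div_eq_zero_iff, not_forall, not_or] at h h'
      obtain ⟨rfl, h, -⟩ := h
      obtain ⟨rfl, h', -⟩ := h'
      -- Both vectors sit over the same basis state of `A`; the rows `i` and `i'` there are nonzero,
      -- which supplies the last two premises of `hdis`.
      obtain ⟨b₁, h₁⟩ := hex (right_ne_zero_of_mul hp)
      obtain ⟨b₂, h₂⟩ := hex (right_ne_zero_of_mul hp')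
      obtain ⟨rfl, rfl⟩ := hdis i i' s s' _ b b₁ b₂ h h' h₁ h₂
      rfl)
  obtain ⟨G, hG, hGx⟩ := exists_orthonormal_of_disjoint
    (fun (p : J) (x : α × β) =>
      if x.1 = p.1.2.1 then φ p.1.1 p.1.2.2 x.2 / (n p.1.1 p.1.2.2 : ℂ) else 0)
    (fun p => hunit _ _ _ (right_ne_zero_of_mul p.2)) (by
      rintro ⟨⟨i, s, t⟩, hp⟩ ⟨⟨i', s', t'⟩, hp'⟩ ⟨u, b⟩ h h'
      simp only [ne_eq, ite_eq_right_iff, div_eq_zero_iff, not_forall, not_or] at h h'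
      obtain ⟨rfl, h, -⟩ := h
      obtain ⟨rfl, h', -⟩ := h'
      obtain ⟨b₁, h₁⟩ := hex (left_ne_zero_of_mul hp)
      obtain ⟨b₂, h₂⟩ := hex (left_ne_zero_of_mul hp')
      obtain ⟨rfl, rfl⟩ := hdis i i' t t' _ b b₁ b₂ h h' h₁ h₂
      rfl)
  have htot : ∑' p : J, ((n p.1.1 p.1.2.1 * n p.1.1 p.1.2.2 : ℝ≥0) : ℝ≥0∞)
      = ∑' i, (∑' s, (n i s : ℝ≥0∞)) ^ 2 := by
    rw [tsum_subtype_eq_of_support_subset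
      (f := fun p : I × α × α => ((n p.1 p.2.1 * n p.1 p.2.2 : ℝ≥0) : ℝ≥0∞))
      (fun p hp => by simpa [J, -ENNReal.coe_mul] using hp), ENNReal.tsum_prod']
    congr 1
    ext1 i
    rw [ENNReal.tsum_prod', sq, ← ENNReal.tsum_mul_right]
    congr 1
    ext1 s
    rw [← ENNReal.tsum_mul_left]
    simp
  rw [← htot] at hfin ⊢
  have hσ := ENNReal.tsum_coe_ne_top_iff_summable.1 hfin
  rw [traceNorm_of_svd (σ := fun p : J => ((n p.1.1 p.1.2.1 * n p.1.1 p.1.2.2 : ℝ≥0) : ℝ))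
    (f := F) (g := G) (fun _ => NNReal.coe_nonneg _) (NNReal.summable_coe.2 hσ) hF hG]
  · simp only [ENNReal.ofReal_coe_nnreal]
  · rintro ⟨a, b⟩ ⟨a', b'⟩
    simp only [hFx, hGx]
    -- In the matrix element between `(a, b)` and `(a', b')` only `s = a'`, `t = a` survive: this
    -- exchange of the two `A` indices is the partial transpose.
    have hinj : Function.Injective (fun i : I => (i, a', a)) := fun i j h => (Prod.ext_iff.1 h).1
    have hterm (p : I × α × α) : (((n p.1 p.2.1 * n p.1 p.2.2 : ℝ≥0) : ℝ) : ℂ)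
        * (if a = p.2.2 then φ p.1 p.2.1 b / (n p.1 p.2.1 : ℂ) else 0)
        * conj (if a' = p.2.1 then φ p.1 p.2.2 b' / (n p.1 p.2.2 : ℂ) else 0)
        = if p.2 = (a', a) then φ p.1 p.2.1 b * conj (φ p.1 p.2.2 b') else 0 := by
      obtain ⟨i, s, t⟩ := p
      by_cases hs : a' = s
      · by_cases ht : a = t
        · subst hs ht
          by_cases h1 : n i a' = 0
          · simp [h1, hz h1]
          · by_cases h2 : n i a = 0
            · simp [h2, hz h2]
            · have h1' : ((n i a' : ℝ) : ℂ) ≠ 0 := by exact_mod_cast h1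
              have h2' : ((n i a : ℝ) : ℂ) ≠ 0 := by exact_mod_cast h2
              simp
              field_simp
        · simp [ht, Ne.symm ht]
      · simp [hs, Ne.symm hs]
    simp only [hterm]
    rw [tsum_subtype_eq_of_support_subset (s := J) (f := fun p : I × α × α =>
      if p.2 = (a', a) then φ p.1 p.2.1 b * conj (φ p.1 p.2.2 b') else 0), ← hinj.tsum_eq]
    · simp [partialTranspose, hρ]
    · rintro ⟨i, s, t⟩ hp
      simp only [Function.mem_support, ne_eq, ite_eq_right_iff, not_forall] at hp
      exact ⟨i, by rw [← hp.1]⟩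
    · rintro ⟨i, s, t⟩ hp
      simp only [Function.mem_support, ne_eq, ite_eq_right_iff, not_forall] at hp
      obtain ⟨-, hp⟩ := hp
      refine mul_ne_zero (fun h => hp ?_) (fun h => hp ?_)
      · simp [hz h]
      · simp [hz h]

/-! ### Sums of families with at most one nonzero member -/

/-- Provides one index to which a sum can be reduced even when no term is nonzero; an arbitrary
index then serves. -/
theorem exists_forall_ne_not {S : Type} [Fintype S] [Nonempty S] {P : S → Prop}
    (h : ∀ a b, P a → P b → a = b) : ∃ a, ∀ b, b ≠ a → ¬ P b := by
  by_cases hP : ∃ a, P a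
  · obtain ⟨a, ha⟩ := hP
    exact ⟨a, fun b hb hb' => hb (h b a hb' ha)⟩
  · exact ⟨Classical.arbitrary S, fun b _ hb => hP ⟨b, hb⟩⟩

theorem sum_sq_of_disjoint {S R : Type} [Fintype S] [CommSemiring R] (F : S → R)
    (h : ∀ a b, F a ≠ 0 → F b ≠ 0 → a = b) : (∑ a, F a) ^ 2 = ∑ a, F a ^ 2 := by
  rcases isEmpty_or_nonempty S with hS | hS
  · simp
  obtain ⟨a, ha⟩ := exists_forall_ne_not h
  rw [Fintype.sum_eq_single a fun b hb => not_not.1 (ha b hb),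
    Fintype.sum_eq_single a fun b hb => by rw [not_not.1 (ha b hb), zero_pow two_ne_zero]]

theorem sum_mul_conj_of_disjoint {S : Type} [Fintype S] (F G : S → ℂ)
    (h : ∀ a b, F a ≠ 0 → G b ≠ 0 → a = b) :
    (∑ a, F a) * conj (∑ a, G a) = ∑ a, F a * conj (G a) := by
  rw [map_sum, Finset.sum_mul_sum]
  refine Finset.sum_congr rfl fun a _ => ?_
  refine Finset.sum_eq_single a (fun b _ hb => ?_) (by simp)
  by_contra hne
  exact hb (h a b (left_ne_zero_of_mul hne) (by simpa using right_ne_zero_of_mul hne)).symm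

theorem enorm_sum_of_disjoint {S : Type} [Fintype S] (F : S → ℂ)
    (h : ∀ a b, F a ≠ 0 → F b ≠ 0 → a = b) : ‖∑ a, F a‖ₑ = ∑ a, ‖F a‖ₑ := by
  rcases isEmpty_or_nonempty S with hS | hS
  · simp
  obtain ⟨a, ha⟩ := exists_forall_ne_not h
  rw [Fintype.sum_eq_single a fun b hb => not_not.1 (ha b hb),
    Fintype.sum_eq_single a fun b hb => by rw [not_not.1 (ha b hb), enorm_zero]]

theorem ENNReal.tsum_finset_sum_mul {S E : Type} [Fintype S] (A : S → ℝ≥0∞) (f : S → E → ℝ≥0∞) :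
    ∑' e, ∑ a, A a * f a e = ∑ a, A a * ∑' e, f a e := by
  rw [Summable.tsum_finsetSum fun _ _ => ENNReal.summable]
  simp only [ENNReal.tsum_mul_left]

/-! ### Torus states glued from interface ground states -/

/-- Cylinders with basis states `K` glued along four interfaces with mode numbers `E`. In sector `a`
the ground state of an interface is `∑ w_a(e) |e⟩ ⊗ |e⟩`, and the remaining degrees of freedom of the
`i`-th cylinder are a function of the mode numbers of its edges. -/
structure GluedTorus (S E K : Type) where
  left : K → E
  right : K → E
  cyl : Fin 4 → E → E → K
  left_cyl : ∀ i e e', left (cyl i e e') = e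
  right_cyl : ∀ i e e', right (cyl i e e') = e'
  weight : S → E → ℂ
  coeff : S → ℂ
  coeff_ne : ∀ a, coeff a ≠ 0
  weight_disjoint : ∀ a b e, weight a e ≠ 0 → weight b e ≠ 0 → a = b
  exists_weight : ∀ a, ∃ e, weight a e ≠ 0
  weight_summable : ∀ a, Summable fun e => ‖weight a e‖

namespace GluedTorus

variable {S E K : Type} (T : GluedTorus S E K)

open Classical in
/-- The unnormalized sector states. -/
def sectorState (a : S) (x : Fin 4 → K) : ℂ :=
  if ∀ i, x i = T.cyl i (T.left (x i)) (T.left (x (i + 1)))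
  then T.coeff a * ∏ i, T.weight a (T.left (x i)) else 0

/-- `∑_e |w_a(e)|` -/
def norm1 (a : S) : ℝ≥0 := ∑' e, ‖T.weight a e‖₊

/-- `∑_e |w_a(e)|²` -/
def norm2 (a : S) : ℝ≥0 := ∑' e, ‖T.weight a e‖₊ ^ 2

theorem tsum_weight (a : S) : ∑' e, ‖T.weight a e‖ₑ = T.norm1 a := by
  rw [norm1, ENNReal.coe_tsum]
  · rfl
  · exact NNReal.summable_coe.1 (T.weight_summable a)

theorem summable_weight_sq (a : S) : Summable fun e => ‖T.weight a e‖₊ ^ 2 := by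
  have h : ∑' e, ((‖T.weight a e‖₊ ^ 2 : ℝ≥0) : ℝ≥0∞) ≠ ⊤ := by
    have h1 : ∑' e, ((‖T.weight a e‖₊ ^ 2 : ℝ≥0) : ℝ≥0∞) ≤ (T.norm1 a : ℝ≥0∞) * T.norm1 a := by
      nth_rw 2 [← T.tsum_weight a]
      rw [← ENNReal.tsum_mul_left]
      refine ENNReal.tsum_le_tsum fun e => ?_
      rw [ENNReal.coe_pow, sq]
      refine mul_le_mul_left ?_ _
      rw [← T.tsum_weight a]
      exact ENNReal.le_tsum e
    exact ne_top_of_le_ne_top (by finiteness) h1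
  exact ENNReal.tsum_coe_ne_top_iff_summable.1 h

theorem tsum_weight_sq (a : S) : ∑' e, ‖T.weight a e‖ₑ ^ 2 = T.norm2 a := by
  rw [norm2, ENNReal.coe_tsum (T.summable_weight_sq a)]
  simp only [ENNReal.coe_pow]
  rfl

theorem norm1_pos (a : S) : 0 < T.norm1 a := by
  obtain ⟨e, he⟩ := T.exists_weight a
  exact NNReal.tsum_pos (NNReal.summable_coe.1 (T.weight_summable a)) e (nnnorm_pos.2 he)

theorem norm2_pos (a : S) : 0 < T.norm2 a := by
  obtain ⟨e, he⟩ := T.exists_weight a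
  exact NNReal.tsum_pos (T.summable_weight_sq a) e (pow_pos (nnnorm_pos.2 he) 2)

/-- Four cylinders whose edges match, with the remaining degrees of freedom as in the state. -/
def Glued (k₀ k₁ k₂ k₃ : K) : Prop :=
  k₀ = T.cyl 0 (T.left k₀) (T.left k₁) ∧ k₁ = T.cyl 1 (T.left k₁) (T.left k₂) ∧
    k₂ = T.cyl 2 (T.left k₂) (T.left k₃) ∧ k₃ = T.cyl 3 (T.left k₃) (T.left k₀)

variable {T} in
theorem Glued.exists {k₀ k₁ k₂ k₃ : K} (h : T.Glued k₀ k₁ k₂ k₃) : ∃ e₀ e₁ e₂ e₃,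
    k₀ = T.cyl 0 e₀ e₁ ∧ k₁ = T.cyl 1 e₁ e₂ ∧ k₂ = T.cyl 2 e₂ e₃ ∧ k₃ = T.cyl 3 e₃ e₀ :=
  ⟨_, _, _, _, h⟩

theorem glued_cyl (e₀ e₁ e₂ e₃ : E) :
    T.Glued (T.cyl 0 e₀ e₁) (T.cyl 1 e₁ e₂) (T.cyl 2 e₂ e₃) (T.cyl 3 e₃ e₀) := by
  simp [Glued, T.left_cyl]

theorem cyl_inj {i : Fin 4} {e e' f f' : E} (h : T.cyl i e e' = T.cyl i f f') :
    e = f ∧ e' = f' := by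
  constructor
  · rw [← T.left_cyl i e e', h, T.left_cyl]
  · rw [← T.right_cyl i e e', h, T.right_cyl]

open Classical in
theorem sectorState_apply (a : S) (k₀ k₁ k₂ k₃ : K) :
    T.sectorState a ![k₀, k₁, k₂, k₃] = if T.Glued k₀ k₁ k₂ k₃ then
      T.coeff a * (T.weight a (T.left k₀) * T.weight a (T.left k₁) * T.weight a (T.left k₂)
        * T.weight a (T.left k₃)) else 0 := by
  rw [sectorState, Fin.prod_univ_four]
  have h : (∀ i, ![k₀, k₁, k₂, k₃] i = T.cyl i (T.left (![k₀, k₁, k₂, k₃] i))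
      (T.left (![k₀, k₁, k₂, k₃] (i + 1)))) ↔ T.Glued k₀ k₁ k₂ k₃ := by
    rw [Fin.forall_fin_succ, Fin.forall_fin_succ, Fin.forall_fin_succ, Fin.forall_fin_succ]
    simp [Glued]
  simp only [h]
  rfl

/-- Parametrizing the support by the four interface mode numbers factors the squared norm into four
copies of `norm2`. -/
theorem enorm_tsum_sectorState (a : S) :
    ∑' x, ‖T.sectorState a x‖ₑ ^ 2 = ((‖T.coeff a‖₊ * T.norm2 a ^ 2) ^ 2 : ℝ≥0) := by
  let g : E × E × E × E → Fin 4 → K := fun p =>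
    ![T.cyl 0 p.1 p.2.1, T.cyl 1 p.2.1 p.2.2.1, T.cyl 2 p.2.2.1 p.2.2.2, T.cyl 3 p.2.2.2 p.1]
  have hg : Function.Injective g := by
    rintro ⟨e₀, e₁, e₂, e₃⟩ ⟨f₀, f₁, f₂, f₃⟩ h
    obtain ⟨h0, h1⟩ := T.cyl_inj (congrFun h 0)
    obtain ⟨h2, h3⟩ := T.cyl_inj (congrFun h 2)
    simp only at h0 h1 h2 h3
    rw [h0, h1, h2, h3]
  rw [← hg.tsum_eq]
  · simp only [g, sectorState_apply, glued_cyl, if_true, left_cyl, enorm_mul, mul_pow,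
      ENNReal.tsum_prod', ENNReal.tsum_mul_left, ENNReal.tsum_mul_right, tsum_weight_sq]
    push_cast
    rw [enorm_eq_nnnorm]
    ring
  · intro x hx
    have hx' : T.sectorState a x ≠ 0 := by
      intro h0
      simp [h0] at hx
    have hxe : x = ![x 0, x 1, x 2, x 3] := by
      ext i
      fin_cases i <;> rfl
    rw [hxe, sectorState_apply] at hx'
    have hG : T.Glued (x 0) (x 1) (x 2) (x 3) := by
      by_contra h
      simp [h] at hx'
    obtain ⟨e₀, e₁, e₂, e₃, h0, h1, h2, h3⟩ := hG.exists
    refine ⟨(e₀, e₁, e₂, e₃), ?_⟩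
    rw [hxe, h0, h1, h2, h3]

theorem sqrt_tsum_sectorState (a : S) :
    Real.sqrt (∑' x, ‖T.sectorState a x‖ ^ 2) = ‖T.coeff a‖ * (T.norm2 a : ℝ) ^ 2 := by
  have h : ∑' x, ‖T.sectorState a x‖ ^ 2 = (‖T.coeff a‖ * (T.norm2 a : ℝ) ^ 2) ^ 2 := by
    have h1 := congrArg ENNReal.toReal (T.enorm_tsum_sectorState a)
    rw [ENNReal.tsum_toReal_eq (fun x => by finiteness)] at h1
    simpa using h1
  rw [h, Real.sqrt_sq (by positivity)]

-- Row norms are indexed by arbitrary cylinder states but vanish off the image of `cyl i`; this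
-- converts sums over them into sums over the two edges.
open Classical in
theorem tsum_cyl (i : Fin 4) (f : E → E → ℝ≥0∞) :
    ∑' k, (if k = T.cyl i (T.left k) (T.right k) then f (T.left k) (T.right k) else 0)
      = ∑' e, ∑' e', f e e' := by
  rw [← ENNReal.tsum_prod]
  have hg : Function.Injective fun p : E × E => T.cyl i p.1 p.2 := fun p q h =>
    Prod.ext (T.cyl_inj h).1 (T.cyl_inj h).2
  rw [← hg.tsum_eq]
  · simp [T.left_cyl, T.right_cyl]
  · intro k hk
    simp only [Function.mem_support, ne_eq, ite_eq_right_iff, not_forall] at hk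
    exact ⟨(T.left k, T.right k), hk.1.symm⟩

variable (ψ : S → ℂ)

/-- The amplitude of the sector `a` relative to the product of the interface weights. -/
def sectorAmp (a : S) : ℂ := ψ a * (T.coeff a / ((‖T.coeff a‖ * (T.norm2 a : ℝ) ^ 2 : ℝ) : ℂ))

/-- The modulus of `coeff` cancels against the normalization, so the zero-mode amplitude has no
influence on any trace norm. -/
theorem nnnorm_sectorAmp (a : S) : ‖T.sectorAmp ψ a‖₊ = ‖ψ a‖₊ / T.norm2 a ^ 2 := by
  have h := T.coeff_ne a
  have h1 : ‖T.coeff a‖₊ ≠ 0 := by simpa using h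
  have h2 := (T.norm2_pos a).ne'
  simp only [sectorAmp, nnnorm_mul, nnnorm_div, Complex.nnnorm_real, nnnorm_pow, nnnorm_norm,
    NNReal.nnnorm_eq]
  field_simp

variable [Fintype S]

/-- The amplitude of a configuration of interface mode numbers. -/
def edgeAmp (e₀ e₁ e₂ e₃ : E) : ℂ :=
  ∑ a, T.sectorAmp ψ a * (T.weight a e₀ * T.weight a e₁ * T.weight a e₂ * T.weight a e₃)

open Classical in
theorem torusState_apply (k₀ k₁ k₂ k₃ : K) :
    torusState T.sectorState ψ ![k₀, k₁, k₂, k₃] = if T.Glued k₀ k₁ k₂ k₃ then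
      T.edgeAmp ψ (T.left k₀) (T.left k₁) (T.left k₂) (T.left k₃) else 0 := by
  simp only [torusState, sqrt_tsum_sectorState, sectorState_apply]
  split_ifs with h
  · refine Finset.sum_congr rfl fun a _ => ?_
    rw [sectorAmp]
    ring
  · simp

variable {T ψ} in
theorem exists_of_torusState_ne {k₀ k₁ k₂ k₃ : K}
    (h : torusState T.sectorState ψ ![k₀, k₁, k₂, k₃] ≠ 0) : ∃ e₀ e₁ e₂ e₃,
    k₀ = T.cyl 0 e₀ e₁ ∧ k₁ = T.cyl 1 e₁ e₂ ∧ k₂ = T.cyl 2 e₂ e₃ ∧ k₃ = T.cyl 3 e₃ e₀ := by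
  rw [torusState_apply] at h
  by_cases hG : T.Glued k₀ k₁ k₂ k₃
  · exact hG.exists
  · simp [hG] at h

theorem torusState_cyl (e₀ e₁ e₂ e₃ : E) :
    torusState T.sectorState ψ ![T.cyl 0 e₀ e₁, T.cyl 1 e₁ e₂, T.cyl 2 e₂ e₃, T.cyl 3 e₃ e₀]
      = T.edgeAmp ψ e₀ e₁ e₂ e₃ := by
  simp [torusState_apply, glued_cyl, left_cyl]

theorem enorm_edgeAmp (e₀ e₁ e₂ e₃ : E) : ‖T.edgeAmp ψ e₀ e₁ e₂ e₃‖ₑ = ∑ a, (‖T.sectorAmp ψ a‖₊ : ℝ≥0∞) *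
    (‖T.weight a e₀‖ₑ * ‖T.weight a e₁‖ₑ * ‖T.weight a e₂‖ₑ * ‖T.weight a e₃‖ₑ) := by
  rw [edgeAmp, enorm_sum_of_disjoint]
  · simp only [enorm_mul]
    rfl
  · intro a b ha hb
    refine T.weight_disjoint a b e₃ ?_ ?_
    · exact right_ne_zero_of_mul (right_ne_zero_of_mul ha)
    · exact right_ne_zero_of_mul (right_ne_zero_of_mul hb)

theorem enorm_edgeAmp_sq (e₀ e₁ e₂ e₃ : E) : ‖T.edgeAmp ψ e₀ e₁ e₂ e₃‖ₑ ^ 2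
    = ∑ a, (‖T.sectorAmp ψ a‖₊ : ℝ≥0∞) ^ 2 * (‖T.weight a e₀‖ₑ ^ 2 * ‖T.weight a e₁‖ₑ ^ 2
      * ‖T.weight a e₂‖ₑ ^ 2 * ‖T.weight a e₃‖ₑ ^ 2) := by
  rw [enorm_edgeAmp, sum_sq_of_disjoint]
  · simp only [mul_pow]
  · intro a b ha hb
    refine T.weight_disjoint a b e₃ ?_ ?_
    · simpa using right_ne_zero_of_mul (right_ne_zero_of_mul ha)
    · simpa using right_ne_zero_of_mul (right_ne_zero_of_mul hb)

end GluedTorus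

/-! ### Trace norms of the partial transposes in the two geometries. -/

namespace GluedTorus

variable {S E K : Type} (T : GluedTorus S E K) [Fintype S] (ψ : S → ℂ)

-- The mixture has one member. The row of `A` with edges `e₀`, `e₁` sums over `e₂`, `e₃`, and these
-- two sums in quadrature give one factor `norm2`. The remaining sum over rows gives `norm1 ^ 2`,
-- with sectors added before the final square.
open Classical in
theorem traceNorm_AB1CB2 :
    traceNorm (partialTranspose (rhoAB1CB2 (torusState T.sectorState ψ)))
      = ((∑ a, ‖T.sectorAmp ψ a‖₊ * T.norm2 a * T.norm1 a ^ 2) ^ 2 : ℝ≥0) := by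
  set Ψ := torusState T.sectorState ψ with hΨ
  have hval : ∑' s : K, (((if s = T.cyl 0 (T.left s) (T.right s) then ∑ a, ‖T.sectorAmp ψ a‖₊ *
      T.norm2 a * (‖T.weight a (T.left s)‖₊ * ‖T.weight a (T.right s)‖₊) else 0) : ℝ≥0) : ℝ≥0∞)
      = ((∑ a, ‖T.sectorAmp ψ a‖₊ * T.norm2 a * T.norm1 a ^ 2 : ℝ≥0) : ℝ≥0∞) := by
    have h := T.tsum_cyl 0 fun e e' => ∑ a, (‖T.sectorAmp ψ a‖₊ : ℝ≥0∞) *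
      T.norm2 a * (‖T.weight a e‖ₑ * ‖T.weight a e'‖ₑ)
    simp only [ENNReal.tsum_finset_sum_mul, ENNReal.tsum_mul_left, ENNReal.tsum_mul_right,
      tsum_weight] at h
    push_cast [sq]
    rw [← h]
    congr 1
    ext1 s
    split_ifs
    · push_cast
      rfl
    · rfl
  rw [traceNorm_partialTranspose_mixture (I := Unit)
    (fun _ s b => Ψ ![s, b.1.1, b.2, b.1.2])
    (fun _ s => if s = T.cyl 0 (T.left s) (T.right s) then ∑ a, ‖T.sectorAmp ψ a‖₊ *
      T.norm2 a * (‖T.weight a (T.left s)‖₊ * ‖T.weight a (T.right s)‖₊) else 0)]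
  · simp only [hval]
    simp
  · intro x y
    simp [rhoAB1CB2, pureDensity]
  · intro _ s
    have hg : Function.Injective fun p : E × E =>
        ((T.cyl 1 (T.right s) p.1, T.cyl 3 p.2 (T.left s)), T.cyl 2 p.1 p.2) := fun p q h =>
      Prod.ext (T.cyl_inj (Prod.ext_iff.1 h).2).1 (T.cyl_inj (Prod.ext_iff.1 h).2).2
    rw [← hg.tsum_eq]
    · by_cases hs : s = T.cyl 0 (T.left s) (T.right s)
      · rw [if_pos hs]
        have h1 (p : E × E) : Ψ ![s, T.cyl 1 (T.right s) p.1, T.cyl 2 p.1 p.2,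
            T.cyl 3 p.2 (T.left s)] = T.edgeAmp ψ (T.left s) (T.right s) p.1 p.2 := by
          rw [← torusState_cyl, ← hs]
        simp only [h1, enorm_edgeAmp_sq]
        rw [ENNReal.tsum_prod']
        simp only [ENNReal.tsum_finset_sum_mul, ENNReal.tsum_mul_left, ENNReal.tsum_mul_right,
          tsum_weight_sq]
        push_cast
        rw [sum_sq_of_disjoint]
        · refine Finset.sum_congr rfl fun a _ => ?_
          simp only [enorm_eq_nnnorm]
          ring
        · intro a b ha hb
          refine T.weight_disjoint a b (T.right s) ?_ ?_
          · simpa using right_ne_zero_of_mul (right_ne_zero_of_mul ha)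
          · simpa using right_ne_zero_of_mul (right_ne_zero_of_mul hb)
      · rw [if_neg hs]
        have h1 (p : E × E) : Ψ ![s, T.cyl 1 (T.right s) p.1, T.cyl 2 p.1 p.2,
            T.cyl 3 p.2 (T.left s)] = 0 := by
          by_contra h
          obtain ⟨e₀, e₁, e₂, e₃, rfl, -⟩ := exists_of_torusState_ne h
          exact hs (by rw [T.left_cyl, T.right_cyl])
        simp [h1]
    · rintro ⟨⟨k₁, k₃⟩, k₂⟩ h
      have h' : Ψ ![s, k₁, k₂, k₃] ≠ 0 := fun h0 => by simp [h0] at h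
      obtain ⟨e₀, e₁, e₂, e₃, rfl, rfl, rfl, rfl⟩ := exists_of_torusState_ne h'
      exact ⟨(e₂, e₃), by simp [T.left_cyl, T.right_cyl]⟩
  -- The left edge of `B₁` and the right edge of `B₂` repeat the two edges of `A`, so a state of the
  -- complement determines the row.
  · rintro - - s s' - ⟨⟨k₁, k₃⟩, k₂⟩ - - h h' - -
    refine ⟨rfl, ?_⟩
    obtain ⟨e₀, e₁, e₂, e₃, rfl, h1, h2, h3⟩ := exists_of_torusState_ne h
    obtain ⟨f₀, f₁, f₂, f₃, rfl, h1', h2', h3'⟩ := exists_of_torusState_ne h'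
    rw [(T.cyl_inj (h1.symm.trans h1')).1, (T.cyl_inj (h3.symm.trans h3')).2]
  · simp only [hval]
    simp only [tsum_fintype, Finset.univ_unique, Finset.sum_singleton]
    finiteness

-- The members of the mixture are indexed by the state of `C`, which fixes `e₂`, `e₃` and hence the
-- sector. The sectors are therefore squared separately and then added.
open Classical in
theorem traceNorm_reduceAB_AB1CB2 :
    traceNorm (partialTranspose (reduceAB (rhoAB1CB2 (torusState T.sectorState ψ))))
      = ((∑ a, ‖T.sectorAmp ψ a‖₊ ^ 2 * T.norm2 a ^ 2 * T.norm1 a ^ 4) : ℝ≥0) := by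
  set Ψ := torusState T.sectorState ψ with hΨ
  let n : K → K → ℝ≥0 := fun c s =>
    if c = T.cyl 2 (T.left c) (T.right c) then
      if s = T.cyl 0 (T.left s) (T.right s) then ‖T.edgeAmp ψ (T.left s) (T.right s)
        (T.left c) (T.right c)‖₊ else 0 else 0
  have hval : ∑' c, (∑' s, (n c s : ℝ≥0∞)) ^ 2
      = ((∑ a, ‖T.sectorAmp ψ a‖₊ ^ 2 * T.norm2 a ^ 2 * T.norm1 a ^ 4 : ℝ≥0) : ℝ≥0∞) := by
    have h1 (c : K) : (∑' s, (n c s : ℝ≥0∞)) ^ 2 = if c = T.cyl 2 (T.left c) (T.right c) then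
        ∑ a, (‖T.sectorAmp ψ a‖₊ ^ 2 * T.norm1 a ^ 4 : ℝ≥0∞) *
          (‖T.weight a (T.left c)‖ₑ ^ 2 * ‖T.weight a (T.right c)‖ₑ ^ 2) else 0 := by
      split_ifs with hc
      · have h := T.tsum_cyl 0 fun e e' => ‖T.edgeAmp ψ e e' (T.left c) (T.right c)‖ₑ
        simp only [enorm_edgeAmp, ENNReal.tsum_finset_sum_mul, ENNReal.tsum_mul_left,
          ENNReal.tsum_mul_right, tsum_weight] at h
        have h2 : ∑' s, (n c s : ℝ≥0∞) = ∑ a, (‖T.sectorAmp ψ a‖₊ : ℝ≥0∞) * (T.norm1 a * T.norm1 a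
            * ‖T.weight a (T.left c)‖ₑ * ‖T.weight a (T.right c)‖ₑ) := by
          rw [← h]
          congr 1
          ext1 s
          simp only [n, if_pos hc]
          split_ifs
          · rw [← enorm_edgeAmp]
            rfl
          · rfl
        rw [h2, sum_sq_of_disjoint]
        · refine Finset.sum_congr rfl fun a _ => ?_
          ring
        · intro a b ha hb
          refine T.weight_disjoint a b (T.right c) ?_ ?_
          · simpa using right_ne_zero_of_mul (right_ne_zero_of_mul ha)
          · simpa using right_ne_zero_of_mul (right_ne_zero_of_mul hb)
      · simp [n, hc]
    simp only [h1]
    have h := T.tsum_cyl 2 fun e e' => ∑ a, (‖T.sectorAmp ψ a‖₊ ^ 2 * T.norm1 a ^ 4 : ℝ≥0∞) *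
          (‖T.weight a e‖ₑ ^ 2 * ‖T.weight a e'‖ₑ ^ 2)
    simp only [ENNReal.tsum_finset_sum_mul, ENNReal.tsum_mul_left, ENNReal.tsum_mul_right,
      tsum_weight_sq] at h
    rw [h]
    push_cast
    refine Finset.sum_congr rfl fun a _ => ?_
    ring
  rw [traceNorm_partialTranspose_mixture
    (fun c s b => Ψ ![s, b.1, c, b.2]) n, hval]
  · intro x y
    simp [reduceAB, traceSnd, rhoAB1CB2, pureDensity]
  · intro c s
    -- Given `A` and `C`, all four interfaces are known, so a row has a single possible entry.
    rw [tsum_eq_single (T.cyl 1 (T.right s) (T.left c), T.cyl 3 (T.right c) (T.left s))]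
    · by_cases hc : c = T.cyl 2 (T.left c) (T.right c)
      · by_cases hs : s = T.cyl 0 (T.left s) (T.right s)
        · have h1 : Ψ ![s, T.cyl 1 (T.right s) (T.left c), c, T.cyl 3 (T.right c) (T.left s)]
            = T.edgeAmp ψ (T.left s) (T.right s) (T.left c) (T.right c) := by
            rw [← torusState_cyl, ← hs, ← hc]
          simp only [n, if_pos hc, if_pos hs, h1]
          rfl
        · have h1 : Ψ ![s, T.cyl 1 (T.right s) (T.left c), c, T.cyl 3 (T.right c) (T.left s)]
              = 0 := by
            by_contra h
            obtain ⟨e₀, e₁, e₂, e₃, rfl, -⟩ := exists_of_torusState_ne h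
            exact hs (by rw [T.left_cyl, T.right_cyl])
          simp [n, hs, h1]
      · have h1 : Ψ ![s, T.cyl 1 (T.right s) (T.left c), c, T.cyl 3 (T.right c) (T.left s)]
            = 0 := by
          by_contra h
          obtain ⟨e₀, e₁, e₂, e₃, -, -, rfl, -⟩ := exists_of_torusState_ne h
          exact hc (by rw [T.left_cyl, T.right_cyl])
        simp [n, hc, h1]
    · rintro ⟨k₁, k₃⟩ hne
      by_contra h
      have h' : Ψ ![s, k₁, c, k₃] ≠ 0 := fun h0 => by simp [h0] at h
      obtain ⟨e₀, e₁, e₂, e₃, rfl, rfl, rfl, rfl⟩ := exists_of_torusState_ne h'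
      simp [T.left_cyl, T.right_cyl] at hne
  · rintro c c' s s' - ⟨k₁, k₃⟩ - - h h' - -
    obtain ⟨e₀, e₁, e₂, e₃, rfl, h1, rfl, h3⟩ := exists_of_torusState_ne h
    obtain ⟨f₀, f₁, f₂, f₃, rfl, h1', rfl, h3'⟩ := exists_of_torusState_ne h'
    obtain ⟨rfl, rfl⟩ := T.cyl_inj (h1.symm.trans h1')
    obtain ⟨rfl, rfl⟩ := T.cyl_inj (h3.symm.trans h3')
    exact ⟨rfl, rfl⟩
  · rw [hval]
    finiteness

-- The state of `D` fixes `e₃` and `e₀`, and within a row `e₂` is summed in quadrature, whence the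
-- square root of `norm2`. Only `e₁`, the interface between `A` and `B`, is summed with first
-- powers.
open Classical in
theorem traceNorm_ABCD :
    traceNorm (partialTranspose (rhoABCD (torusState T.sectorState ψ)))
      = ((∑ a, ‖T.sectorAmp ψ a‖₊ ^ 2 * T.norm2 a ^ 3 * T.norm1 a ^ 2) : ℝ≥0) := by
  set Ψ := torusState T.sectorState ψ with hΨ
  let n : K → K → ℝ≥0 := fun d s =>
    if d = T.cyl 3 (T.left d) (T.right d) then
      if s = T.cyl 0 (T.left s) (T.right s) then
        if T.left s = T.right d then
          ∑ a, ‖T.sectorAmp ψ a‖₊ * NNReal.sqrt (T.norm2 a) * (‖T.weight a (T.left d)‖₊ *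
            ‖T.weight a (T.right d)‖₊ * ‖T.weight a (T.right s)‖₊) else 0 else 0 else 0
  have hval : ∑' d, (∑' s, (n d s : ℝ≥0∞)) ^ 2
      = ((∑ a, ‖T.sectorAmp ψ a‖₊ ^ 2 * T.norm2 a ^ 3 * T.norm1 a ^ 2 : ℝ≥0) : ℝ≥0∞) := by
    have h1 (d : K) : (∑' s, (n d s : ℝ≥0∞)) ^ 2 = if d = T.cyl 3 (T.left d) (T.right d) then
        ∑ a, (‖T.sectorAmp ψ a‖₊ ^ 2 * T.norm2 a * T.norm1 a ^ 2 : ℝ≥0∞) *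
          (‖T.weight a (T.left d)‖ₑ ^ 2 * ‖T.weight a (T.right d)‖ₑ ^ 2) else 0 := by
      split_ifs with hd
      · have h := T.tsum_cyl 0 fun e e' => if e = T.right d then
          ∑ a, (‖T.sectorAmp ψ a‖₊ * NNReal.sqrt (T.norm2 a) : ℝ≥0∞) * (‖T.weight a (T.left d)‖ₑ *
            ‖T.weight a (T.right d)‖ₑ * ‖T.weight a e'‖ₑ) else 0
        rw [tsum_eq_single (T.right d) (fun e he => by simp [he])] at h
        simp only [if_true, ENNReal.tsum_finset_sum_mul, ENNReal.tsum_mul_left,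
          tsum_weight] at h
        have h2 : ∑' s, (n d s : ℝ≥0∞) = ∑ a, (‖T.sectorAmp ψ a‖₊ * NNReal.sqrt (T.norm2 a) : ℝ≥0∞) *
            (‖T.weight a (T.left d)‖ₑ * ‖T.weight a (T.right d)‖ₑ * T.norm1 a) := by
          rw [← h]
          congr 1
          ext1 s
          simp only [n, if_pos hd]
          split_ifs
          · push_cast
            rfl
          · rfl
          · rfl
        rw [h2, sum_sq_of_disjoint]
        · refine Finset.sum_congr rfl fun a _ => ?_
          have hsq : (NNReal.sqrt (T.norm2 a) : ℝ≥0∞) ^ 2 = T.norm2 a := by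
            rw [← ENNReal.coe_pow, NNReal.sq_sqrt]
          simp only [mul_pow, hsq]
          ring
        · intro a b ha hb
          refine T.weight_disjoint a b (T.right d) ?_ ?_
          · simpa using right_ne_zero_of_mul (left_ne_zero_of_mul (right_ne_zero_of_mul ha))
          · simpa using right_ne_zero_of_mul (left_ne_zero_of_mul (right_ne_zero_of_mul hb))
      · simp [n, hd]
    simp only [h1]
    have h := T.tsum_cyl 3 fun e e' =>
      ∑ a, (‖T.sectorAmp ψ a‖₊ ^ 2 * T.norm2 a * T.norm1 a ^ 2 : ℝ≥0∞) *
          (‖T.weight a e‖ₑ ^ 2 * ‖T.weight a e'‖ₑ ^ 2)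
    simp only [ENNReal.tsum_finset_sum_mul, ENNReal.tsum_mul_left, ENNReal.tsum_mul_right,
      tsum_weight_sq] at h
    rw [h]
    push_cast
    refine Finset.sum_congr rfl fun a _ => ?_
    ring
  rw [traceNorm_partialTranspose_mixture
    (fun d s b => Ψ ![s, b.1, b.2, d]) n, hval]
  · intro x y
    simp [traceSnd, rhoABCD, pureDensity]
  · intro d s
    by_cases hd : d = T.cyl 3 (T.left d) (T.right d) ∧ s = T.cyl 0 (T.left s) (T.right s) ∧
      T.left s = T.right d
    · obtain ⟨hd, hs, hds⟩ := hd
      have hg : Function.Injective fun e : E => (T.cyl 1 (T.right s) e, T.cyl 2 e (T.left d)) :=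
        fun e f h => (T.cyl_inj (Prod.ext_iff.1 h).2).1
      rw [← hg.tsum_eq]
      · have h1 (e : E) : Ψ ![s, T.cyl 1 (T.right s) e, T.cyl 2 e (T.left d), d]
            = T.edgeAmp ψ (T.right d) (T.right s) e (T.left d) := by
          rw [← torusState_cyl, ← hd, ← hds, ← hs]
        simp only [h1, enorm_edgeAmp_sq]
        simp only [ENNReal.tsum_finset_sum_mul, ENNReal.tsum_mul_left, ENNReal.tsum_mul_right,
          tsum_weight_sq]
        simp only [n, if_pos hd, if_pos hs, if_pos hds]
        push_cast
        rw [sum_sq_of_disjoint]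
        · refine Finset.sum_congr rfl fun a _ => ?_
          have hsq : (NNReal.sqrt (T.norm2 a) : ℝ≥0∞) ^ 2 = T.norm2 a := by
            rw [← ENNReal.coe_pow, NNReal.sq_sqrt]
          simp only [enorm_eq_nnnorm, mul_pow, hsq]
          ring
        · intro a b ha hb
          refine T.weight_disjoint a b (T.right s) ?_ ?_
          · simpa using right_ne_zero_of_mul (right_ne_zero_of_mul ha)
          · simpa using right_ne_zero_of_mul (right_ne_zero_of_mul hb)
      · rintro ⟨k₁, k₂⟩ h
        have h' : Ψ ![s, k₁, k₂, d] ≠ 0 := fun h0 => by simp [h0] at h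
        obtain ⟨e₀, e₁, e₂, e₃, rfl, rfl, rfl, rfl⟩ := exists_of_torusState_ne h'
        exact ⟨e₂, by simp [T.left_cyl, T.right_cyl]⟩
    · have h0 (b : K × K) : Ψ ![s, b.1, b.2, d] = 0 := by
        by_contra h
        obtain ⟨e₀, e₁, e₂, e₃, rfl, -, -, rfl⟩ := exists_of_torusState_ne h
        exact hd (by simp [T.left_cyl, T.right_cyl])
      have hn0 : n d s = 0 := by
        simp only [n]
        split_ifs <;> first | rfl | tauto
      simp [h0, hn0]
  -- The state of `B` and `C` fixes `e₁`, `e₂`, `e₃` but not `e₀`. That one comes from the common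
  -- row `t`, whose left edge is the right edge of both `d` and `d'`.
  · rintro d d' s s' t ⟨k₁, k₂⟩ ⟨l₁, l₂⟩ ⟨l₁', l₂'⟩ h h' ht ht'
    obtain ⟨e₀, e₁, e₂, e₃, rfl, h1, h2, rfl⟩ := exists_of_torusState_ne h
    obtain ⟨f₀, f₁, f₂, f₃, rfl, h1', h2', rfl⟩ := exists_of_torusState_ne h'
    obtain ⟨a₀, a₁, a₂, a₃, h4, -, -, h5⟩ := exists_of_torusState_ne ht
    obtain ⟨b₀, b₁, b₂, b₃, h4', -, -, h5'⟩ := exists_of_torusState_ne ht'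
    obtain ⟨rfl, rfl⟩ := T.cyl_inj (h1.symm.trans h1')
    obtain ⟨-, rfl⟩ := T.cyl_inj (h2.symm.trans h2')
    obtain ⟨rfl, -⟩ := T.cyl_inj (h4.symm.trans h4')
    obtain ⟨-, rfl⟩ := T.cyl_inj h5
    obtain ⟨-, rfl⟩ := T.cyl_inj h5'
    exact ⟨rfl, rfl⟩
  · rw [hval]
    finiteness

/-- Tracing over `e₃` only produces `norm2` in each sector. Splitting it into two square roots keeps
the form of an amplitude times a conjugate amplitude, as a mixture of pure states requires. -/
theorem tsum_edgeAmp_mul_conj (e₀ e₁ e₁' e₂ : E) :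
    ∑' e₃, T.edgeAmp ψ e₀ e₁ e₂ e₃ * conj (T.edgeAmp ψ e₀ e₁' e₂ e₃)
      = ∑ a, (T.sectorAmp ψ a * (NNReal.sqrt (T.norm2 a) : ℂ) *
          (T.weight a e₀ * T.weight a e₁ * T.weight a e₂)) *
          conj (T.sectorAmp ψ a * (NNReal.sqrt (T.norm2 a) : ℂ) *
          (T.weight a e₀ * T.weight a e₁' * T.weight a e₂)) := by
  have hZ (a : S) : HasSum (fun e => T.weight a e * conj (T.weight a e)) ((T.norm2 a : ℝ) : ℂ) := by
    have h := NNReal.hasSum_coe.2 (T.summable_weight_sq a).hasSum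
    have h2 := Complex.hasSum_ofReal.2 h
    refine h2.congr_fun fun e => ?_
    rw [Complex.mul_conj, Complex.normSq_eq_norm_sq]
    simp
  have hpt (e₃ : E) : T.edgeAmp ψ e₀ e₁ e₂ e₃ * conj (T.edgeAmp ψ e₀ e₁' e₂ e₃)
      = ∑ a, (T.sectorAmp ψ a * (T.weight a e₀ * T.weight a e₁ * T.weight a e₂) *
        conj (T.sectorAmp ψ a * (T.weight a e₀ * T.weight a e₁' * T.weight a e₂))) *
          (T.weight a e₃ * conj (T.weight a e₃)) := by
    rw [edgeAmp, edgeAmp, sum_mul_conj_of_disjoint]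
    · refine Finset.sum_congr rfl fun a _ => ?_
      simp only [map_mul]
      ring
    · intro a b ha hb
      refine T.weight_disjoint a b e₃ ?_ ?_
      · exact right_ne_zero_of_mul (right_ne_zero_of_mul ha)
      · exact right_ne_zero_of_mul (right_ne_zero_of_mul hb)
  simp only [hpt]
  rw [(hasSum_sum fun a _ => (hZ a).mul_left _).tsum_eq]
  refine Finset.sum_congr rfl fun a _ => ?_
  have hsq : ((T.norm2 a : ℝ) : ℂ)
      = (NNReal.sqrt (T.norm2 a) : ℂ) * (NNReal.sqrt (T.norm2 a) : ℂ) := by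
    rw [← Complex.ofReal_mul, ← NNReal.coe_mul, NNReal.mul_self_sqrt]
  simp only [map_mul, Complex.conj_ofReal, hsq]
  ring

-- Tracing out `C` and `D` leaves a mixture over `(e₀, e₂)`. As before the trace over `C`, `e₁`
-- contributes `norm1 ^ 2` and each of the other three interfaces one `norm2`, so the two trace
-- norms coincide.
open Classical in
theorem traceNorm_reduceAB_ABCD :
    traceNorm (partialTranspose (reduceAB (rhoABCD (torusState T.sectorState ψ))))
      = ((∑ a, ‖T.sectorAmp ψ a‖₊ ^ 2 * T.norm2 a ^ 3 * T.norm1 a ^ 2) : ℝ≥0) := by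
  set Ψ := torusState T.sectorState ψ with hΨ
  let u : E → E → E → ℂ := fun e₀ e₁ e₂ => ∑ a, T.sectorAmp ψ a * (NNReal.sqrt (T.norm2 a) : ℂ) *
          (T.weight a e₀ * T.weight a e₁ * T.weight a e₂)
  have hu (e₀ e₁ e₂ : E) : ‖u e₀ e₁ e₂‖ₑ = ∑ a, (‖T.sectorAmp ψ a‖₊ * NNReal.sqrt (T.norm2 a) : ℝ≥0∞) *
      (‖T.weight a e₀‖ₑ * ‖T.weight a e₁‖ₑ * ‖T.weight a e₂‖ₑ) := by
    simp only [u]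
    rw [enorm_sum_of_disjoint]
    · refine Finset.sum_congr rfl fun a _ => ?_
      simp only [enorm_eq_nnnorm, nnnorm_mul, Complex.nnnorm_real, NNReal.nnnorm_eq,
        ENNReal.coe_mul]
    · intro a b ha hb
      refine T.weight_disjoint a b e₂ ?_ ?_
      · exact right_ne_zero_of_mul (right_ne_zero_of_mul ha)
      · exact right_ne_zero_of_mul (right_ne_zero_of_mul hb)
  let n : E × E → K → ℝ≥0 := fun p s =>
      if s = T.cyl 0 (T.left s) (T.right s) then
        if T.left s = p.1 then ‖u p.1 (T.right s) p.2‖₊ else 0 else 0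
  have hval : ∑' p, (∑' s, (n p s : ℝ≥0∞)) ^ 2
      = ((∑ a, ‖T.sectorAmp ψ a‖₊ ^ 2 * T.norm2 a ^ 3 * T.norm1 a ^ 2 : ℝ≥0) : ℝ≥0∞) := by
    have h1 (p : E × E) : (∑' s, (n p s : ℝ≥0∞)) ^ 2 =
        ∑ a, (‖T.sectorAmp ψ a‖₊ ^ 2 * T.norm2 a * T.norm1 a ^ 2 : ℝ≥0∞) *
          (‖T.weight a p.1‖ₑ ^ 2 * ‖T.weight a p.2‖ₑ ^ 2) := by
      have h := T.tsum_cyl 0 fun e e' => if e = p.1 then ‖u p.1 e' p.2‖ₑ else 0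
      rw [tsum_eq_single p.1 (fun e he => by simp [he])] at h
      simp only [if_true] at h
      have h2 : ∑' s, (n p s : ℝ≥0∞) = ∑ a, (‖T.sectorAmp ψ a‖₊ * NNReal.sqrt (T.norm2 a) : ℝ≥0∞) *
          (‖T.weight a p.1‖ₑ * T.norm1 a * ‖T.weight a p.2‖ₑ) := by
        simp only [hu, ENNReal.tsum_finset_sum_mul, ENNReal.tsum_mul_left,
          ENNReal.tsum_mul_right, tsum_weight] at h
        rw [← h]
        congr 1
        ext1 s
        simp only [n]
        split_ifs
        · rw [← hu]
          rfl
        · rfl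
        · rfl
      rw [h2, sum_sq_of_disjoint]
      · refine Finset.sum_congr rfl fun a _ => ?_
        have hsq : (NNReal.sqrt (T.norm2 a) : ℝ≥0∞) ^ 2 = T.norm2 a := by
          rw [← ENNReal.coe_pow, NNReal.sq_sqrt]
        simp only [mul_pow, hsq]
        ring
      · intro a b ha hb
        refine T.weight_disjoint a b p.2 ?_ ?_
        · simpa using right_ne_zero_of_mul (right_ne_zero_of_mul ha)
        · simpa using right_ne_zero_of_mul (right_ne_zero_of_mul hb)
    simp only [h1]
    rw [ENNReal.tsum_prod']
    simp only [ENNReal.tsum_finset_sum_mul, ENNReal.tsum_mul_left, ENNReal.tsum_mul_right,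
      tsum_weight_sq]
    push_cast
    refine Finset.sum_congr rfl fun a _ => ?_
    ring
  let φ : E × E → K → K → ℂ := fun p s b =>
    if s = T.cyl 0 p.1 (T.right s) ∧ b = T.cyl 1 (T.right s) p.2 then u p.1 (T.right s) p.2 else 0
  have hφ {p s b} (h : φ p s b ≠ 0) :
      s = T.cyl 0 p.1 (T.right s) ∧ b = T.cyl 1 (T.right s) p.2 := by
    simp only [φ, ne_eq, ite_eq_right_iff, not_forall] at h
    exact h.1
  rw [traceNorm_partialTranspose_mixture φ n, hval]
  · rintro ⟨s, b⟩ ⟨s', b'⟩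
    have hL : reduceAB (rhoABCD Ψ) (s, b) (s', b')
        = ∑' c, ∑' d, Ψ ![s, b, c, d] * conj (Ψ ![s', b', c, d]) := by
      simp [reduceAB, traceSnd, rhoABCD, pureDensity]
    rw [hL]
    by_cases hG : ∃ e₀ e₁ e₁' e₂, s = T.cyl 0 e₀ e₁ ∧ b = T.cyl 1 e₁ e₂ ∧
        s' = T.cyl 0 e₀ e₁' ∧ b' = T.cyl 1 e₁' e₂
    · obtain ⟨e₀, e₁, e₁', e₂, rfl, rfl, rfl, rfl⟩ := hG
      have hg : Function.Injective fun e : E => T.cyl 2 e₂ e := fun e f h => (T.cyl_inj h).2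
      rw [← hg.tsum_eq]
      · have h1 (e₃ : E) : ∑' d, Ψ ![T.cyl 0 e₀ e₁, T.cyl 1 e₁ e₂, T.cyl 2 e₂ e₃, d] *
            conj (Ψ ![T.cyl 0 e₀ e₁', T.cyl 1 e₁' e₂, T.cyl 2 e₂ e₃, d])
            = T.edgeAmp ψ e₀ e₁ e₂ e₃ * conj (T.edgeAmp ψ e₀ e₁' e₂ e₃) := by
          rw [tsum_eq_single (T.cyl 3 e₃ e₀)]
          · rw [hΨ, torusState_cyl, torusState_cyl]
          · intro d hd
            by_contra h
            obtain ⟨f₀, f₁, f₂, f₃, h0, -, h2, h3⟩ := exists_of_torusState_ne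
              (left_ne_zero_of_mul h)
            rw [h3, (T.cyl_inj h0).1, (T.cyl_inj h2).2] at hd
            exact hd rfl
        simp only [h1]
        rw [tsum_edgeAmp_mul_conj, tsum_eq_single (e₀, e₂)]
        · simp only [φ, T.right_cyl, and_self, if_true, u]
          rw [sum_mul_conj_of_disjoint]
          intro a b ha hb
          refine T.weight_disjoint a b e₂ ?_ ?_
          · exact right_ne_zero_of_mul (right_ne_zero_of_mul ha)
          · exact right_ne_zero_of_mul (right_ne_zero_of_mul hb)
        · rintro ⟨f₀, f₂⟩ hf
          by_contra h
          obtain ⟨h0, h1⟩ := hφ (left_ne_zero_of_mul h)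
          exact hf (by rw [(T.cyl_inj h0).1, (T.cyl_inj h1).2])
      · intro c hc
        by_contra hc'
        apply hc
        convert tsum_zero with d
        by_contra h
        obtain ⟨f₀, f₁, f₂, f₃, h0, h1, h2, h3⟩ := exists_of_torusState_ne
          (left_ne_zero_of_mul h)
        exact hc' ⟨f₃, by simp only; rw [h2, (T.cyl_inj h1).2]⟩
    · have h1 : ∀ c d, Ψ ![s, b, c, d] * conj (Ψ ![s', b', c, d]) = 0 := by
        intro c d
        by_contra h
        obtain ⟨e₀, e₁, e₂, e₃, h0, h1, h2, h3⟩ := exists_of_torusState_ne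
          (left_ne_zero_of_mul h)
        obtain ⟨f₀, f₁, f₂, f₃, h0', h1', h2', h3'⟩ := exists_of_torusState_ne
          (by simpa using right_ne_zero_of_mul h)
        obtain ⟨rfl, rfl⟩ := T.cyl_inj (h2.symm.trans h2')
        obtain ⟨-, rfl⟩ := T.cyl_inj (h3.symm.trans h3')
        exact hG ⟨e₀, e₁, f₁, e₂, h0, h1, h0', h1'⟩
      have h2 : ∀ p, φ p s b * conj (φ p s' b') = 0 := by
        intro p
        by_contra h
        obtain ⟨h0, h1⟩ := hφ (left_ne_zero_of_mul h)
        obtain ⟨h0', h1'⟩ := hφ (p := p) (s := s') (b := b')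
          (by simpa using right_ne_zero_of_mul h)
        exact hG ⟨_, _, _, _, h0, h1, h0', h1'⟩
      simp [h1, h2]
  · intro p s
    rw [tsum_eq_single (T.cyl 1 (T.right s) p.2)]
    · have : s = T.cyl 0 p.1 (T.right s) ↔ s = T.cyl 0 (T.left s) (T.right s) ∧ T.left s = p.1 := by
        constructor
        · intro h
          have h1 : T.left s = p.1 := by rw [h, T.left_cyl]
          exact ⟨by rw [h1]; exact h, h1⟩
        · rintro ⟨h, h'⟩
          rw [← h']
          exact h
      simp only [φ, n, this, and_true]
      split_ifs <;> first | rfl | tauto | simp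
    · intro b hb
      have : φ p s b = 0 := by
        by_contra h
        exact hb (hφ h).2
      simp [this]
  -- The state of `B` fixes `e₁` and `e₂`; the common row `t` fixes `e₀`.
  · rintro ⟨e₀, e₂⟩ ⟨f₀, f₂⟩ s s' t b b₁ b₂ h h' ht ht'
    obtain ⟨h0, h1⟩ := hφ h
    obtain ⟨h0', h1'⟩ := hφ h'
    obtain ⟨h2, -⟩ := hφ ht
    obtain ⟨h2', -⟩ := hφ ht'
    simp only at h0 h1 h0' h1' h2 h2'
    obtain ⟨rfl, -⟩ := T.cyl_inj (h2.symm.trans h2')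
    obtain ⟨hr, rfl⟩ := T.cyl_inj (h1.symm.trans h1')
    exact ⟨rfl, by rw [h0, h0', hr]⟩
  · rw [hval]
    finiteness

end GluedTorus

/-! ### Trace norms in terms of the interface ratios. -/

namespace GluedTorus

variable {S E K : Type} (T : GluedTorus S E K)

/-- `(∑_e |w_a(e)|)² / ∑_e |w_a(e)|²` -/
def ratio (a : S) : ℝ := (T.norm1 a : ℝ) ^ 2 / T.norm2 a

theorem ratio_pos (a : S) : 0 < T.ratio a :=
  div_pos (pow_pos (T.norm1_pos a) 2) (T.norm2_pos a)

variable [Fintype S] (ψ : S → ℂ)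

theorem traceNorm_AB1CB2_eq_ratio :
    traceNorm (partialTranspose (rhoAB1CB2 (torusState T.sectorState ψ)))
      = ENNReal.ofReal ((∑ a, ‖ψ a‖ * T.ratio a) ^ 2) := by
  rw [traceNorm_AB1CB2, ← ENNReal.ofReal_coe_nnreal]
  congr 1
  push_cast
  congr 1
  refine Finset.sum_congr rfl fun a _ => ?_
  have h := (T.norm2_pos a).ne'
  have h' : (T.norm2 a : ℝ) ≠ 0 := by exact_mod_cast h
  rw [← coe_nnnorm, nnnorm_sectorAmp, ratio]
  push_cast
  field_simp

theorem traceNorm_reduceAB_AB1CB2_eq_ratio :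
    traceNorm (partialTranspose (reduceAB (rhoAB1CB2 (torusState T.sectorState ψ))))
      = ENNReal.ofReal (∑ a, (‖ψ a‖ * T.ratio a) ^ 2) := by
  rw [traceNorm_reduceAB_AB1CB2, ← ENNReal.ofReal_coe_nnreal]
  congr 1
  push_cast
  refine Finset.sum_congr rfl fun a _ => ?_
  have h := (T.norm2_pos a).ne'
  have h' : (T.norm2 a : ℝ) ≠ 0 := by exact_mod_cast h
  rw [← coe_nnnorm, nnnorm_sectorAmp, ratio]
  push_cast
  field_simp

theorem traceNorm_ABCD_eq_ratio :
    traceNorm (partialTranspose (rhoABCD (torusState T.sectorState ψ)))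
      = ENNReal.ofReal (∑ a, ‖ψ a‖ ^ 2 * T.ratio a) := by
  rw [traceNorm_ABCD, ← ENNReal.ofReal_coe_nnreal]
  congr 1
  push_cast
  refine Finset.sum_congr rfl fun a _ => ?_
  have h := (T.norm2_pos a).ne'
  have h' : (T.norm2 a : ℝ) ≠ 0 := by exact_mod_cast h
  rw [← coe_nnnorm, nnnorm_sectorAmp, ratio]
  push_cast
  field_simp

theorem disentanglingCondition_ABCD :
    DisentanglingCondition (rhoABCD (torusState T.sectorState ψ)) := by
  rw [DisentanglingCondition, logNeg, logNeg, traceNorm_ABCD, traceNorm_reduceAB_ABCD]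

end GluedTorus

/-! ### The single-sector criterion and the negativities obtained from the ratios. -/

theorem sq_sum_eq_sum_sq_iff {S : Type} [Fintype S] {ψ : S → ℂ} (hψ : ∑ a, ‖ψ a‖ ^ 2 = 1)
    {d : S → ℝ} (hd : ∀ a, 0 < d a) :
    (∑ a, ‖ψ a‖ * d a) ^ 2 = ∑ a, (‖ψ a‖ * d a) ^ 2 ↔ InSingleSector ψ := by
  constructor
  · intro h
    obtain ⟨a, ha⟩ : ∃ a, ψ a ≠ 0 := by
      by_contra! h0
      simp [h0] at hψ
    have hy (b : S) : 0 ≤ ‖ψ b‖ * d b := mul_nonneg (norm_nonneg _) (hd b).le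
    have hle (b : S) : ‖ψ b‖ * d b ≤ ∑ c, ‖ψ c‖ * d c :=
      Finset.single_le_sum (f := fun c => ‖ψ c‖ * d c) (fun c _ => hy c) (Finset.mem_univ b)
    -- The cross terms of the square, written as a sum of nonnegative terms. At an index with `ψ a ≠
    -- 0` the second factor must vanish, which leaves nothing for the other sectors.
    have h1 : ∑ b, ‖ψ b‖ * d b * (∑ c, ‖ψ c‖ * d c - ‖ψ b‖ * d b) = 0 := by
      simp only [mul_sub, Finset.sum_sub_distrib]
      rw [← Finset.sum_mul, ← sq, h]
      simp [sq]
    have h2 := (Finset.sum_eq_zero_iff_of_nonneg fun b _ =>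
      mul_nonneg (hy b) (sub_nonneg.2 (hle b))).1 h1 a (Finset.mem_univ a)
    have h3 : ∑ c, ‖ψ c‖ * d c = ‖ψ a‖ * d a := by
      have : ‖ψ a‖ * d a ≠ 0 := mul_ne_zero (norm_ne_zero_iff.2 ha) (hd a).ne'
      have := (mul_eq_zero.1 h2).resolve_left this
      linarith
    classical
    have h4 : ∀ b, b ≠ a → ψ b = 0 := by
      intro b hb
      rw [← Finset.add_sum_erase _ _ (Finset.mem_univ a)] at h3
      have h5 := (Finset.sum_eq_zero_iff_of_nonneg fun c _ => hy c).1 (add_eq_left.1 h3) b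
        (Finset.mem_erase.2 ⟨hb, Finset.mem_univ b⟩)
      simpa using (mul_eq_zero.1 h5).resolve_right (hd b).ne'
    refine ⟨a, ?_, h4⟩
    rw [Fintype.sum_eq_single a fun b hb => by simp [h4 b hb]] at hψ
    exact (pow_eq_one_iff_of_nonneg (norm_nonneg _) two_ne_zero).1 hψ
  · rintro ⟨a, -, h⟩
    rw [Fintype.sum_eq_single a fun b hb => by simp [h b hb],
      Fintype.sum_eq_single a fun b hb => by simp [h b hb]]

theorem log_sq_sum_div_eq_zero_iff {S : Type} [Fintype S] {ψ : S → ℂ} (hψ : ∑ a, ‖ψ a‖ ^ 2 = 1)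
    {d : S → ℝ} (hd : ∀ a, 0 < d a) :
    Real.log ((∑ a, ‖ψ a‖ * d a) ^ 2 / ∑ a, ‖ψ a‖ ^ 2 * d a ^ 2) = 0 ↔ InSingleSector ψ := by
  obtain ⟨a, ha⟩ : ∃ a, ψ a ≠ 0 := by
    by_contra! h0
    simp [h0] at hψ
  have ha' := norm_pos_iff.2 ha
  have h1 : 0 < (∑ a, ‖ψ a‖ * d a) ^ 2 := by
    refine pow_pos (Finset.sum_pos' (fun b _ => ?_) ⟨a, Finset.mem_univ a, ?_⟩) 2
    · have := hd b; positivity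
    · have := hd a; positivity
  have h2 : 0 < ∑ a, ‖ψ a‖ ^ 2 * d a ^ 2 := by
    refine Finset.sum_pos' (fun b _ => ?_) ⟨a, Finset.mem_univ a, ?_⟩
    · have := hd b; positivity
    · have := hd a; positivity
  rw [← sq_sum_eq_sum_sq_iff hψ hd, Real.log_eq_zero]
  simp only [mul_pow]
  have h3 := div_pos h1 h2
  constructor
  · rintro (h | h | h)
    · exact absurd h h3.ne'
    · exact (div_eq_one_iff_eq h2.ne').1 h
    · linarith
  · intro h
    exact Or.inr (Or.inl ((div_eq_one_iff_eq h2.ne').2 h))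

/-- Negativities of a family of glued torus states whose interface sums scale like the quantum
dimensions `d`. -/
theorem negativity_of_gluedTorus {S E K : Type} [Fintype S] (Φ : ℝ → S → (Fin 4 → K) → ℂ)
    (X : ℝ → S → ℝ)
    (hΦ : ∀ L, 0 < L → ∃ T : GluedTorus S E K, Φ L = T.sectorState ∧ ∀ a, X L a = T.ratio a)
    (d : S → ℝ) (hd : ∀ a, 0 < d a) (g : ℝ → ℝ) (hg : ∀ L, 0 < L → 0 < g L)
    {c : ℝ} (hc : 0 < c)
    (hlim : ∀ a, Filter.Tendsto (fun L => X L a / g L) Filter.atTop (nhds (c * d a)))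
    (ψ : S → ℂ) (hψ : ∑ a, ‖ψ a‖ ^ 2 = 1) :
    (∀ L : ℝ, 0 < L → ∃ e₁ e₂ e₃ e₄ : ℝ,
        logNeg (rhoAB1CB2 (torusState (Φ L) ψ)) = (e₁ : EReal) ∧
        logNeg (reduceAB (rhoAB1CB2 (torusState (Φ L) ψ))) = (e₂ : EReal) ∧
        logNeg (rhoABCD (torusState (Φ L) ψ)) = (e₃ : EReal) ∧
        logNeg (reduceAB (rhoABCD (torusState (Φ L) ψ))) = (e₄ : EReal)) ∧
      Filter.Tendsto
        (fun L : ℝ => (logNeg (rhoAB1CB2 (torusState (Φ L) ψ))).toReal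
          - (logNeg (reduceAB (rhoAB1CB2 (torusState (Φ L) ψ)))).toReal)
        Filter.atTop
        (nhds (Real.log ((∑ a, ‖ψ a‖ * d a) ^ 2 / ∑ a, ‖ψ a‖ ^ 2 * d a ^ 2))) ∧
      (Filter.Tendsto
        (fun L : ℝ => (logNeg (rhoAB1CB2 (torusState (Φ L) ψ))).toReal
          - (logNeg (reduceAB (rhoAB1CB2 (torusState (Φ L) ψ)))).toReal)
        Filter.atTop (nhds 0) ↔ InSingleSector ψ) ∧
      (∀ L : ℝ, 0 < L →
        (DisentanglingCondition (rhoAB1CB2 (torusState (Φ L) ψ)) ↔ InSingleSector ψ)) ∧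
      (∀ L : ℝ, 0 < L → DisentanglingCondition (rhoABCD (torusState (Φ L) ψ))) := by
  obtain ⟨a, ha⟩ : ∃ a, ψ a ≠ 0 := by
    by_contra! h0
    simp [h0] at hψ
  have ha' := norm_pos_iff.2 ha
  have pos1 {x : S → ℝ} (hx : ∀ a, 0 < x a) : 0 < (∑ a, ‖ψ a‖ * x a) ^ 2 := by
    refine pow_pos (Finset.sum_pos' (fun b _ => ?_) ⟨a, Finset.mem_univ a, ?_⟩) 2
    · have := hx b; positivity
    · have := hx a; positivity
  have pos2 {x : S → ℝ} (hx : ∀ a, 0 < x a) : 0 < ∑ a, (‖ψ a‖ * x a) ^ 2 := by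
    refine Finset.sum_pos' (fun b _ => ?_) ⟨a, Finset.mem_univ a, ?_⟩
    · have := hx b; positivity
    · have := hx a; positivity
  have pos3 {x : S → ℝ} (hx : ∀ a, 0 < x a) : 0 < ∑ a, ‖ψ a‖ ^ 2 * x a := by
    refine Finset.sum_pos' (fun b _ => ?_) ⟨a, Finset.mem_univ a, ?_⟩
    · have := hx b; positivity
    · have := hx a; positivity
  have hX {L : ℝ} (hL : 0 < L) (a : S) : 0 < X L a := by
    obtain ⟨T, -, h⟩ := hΦ L hL
    rw [h]
    exact T.ratio_pos a
  have E1 {L : ℝ} (hL : 0 < L) : logNeg (rhoAB1CB2 (torusState (Φ L) ψ))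
      = (Real.log ((∑ a, ‖ψ a‖ * X L a) ^ 2) : ℝ) := by
    obtain ⟨T, h, h'⟩ := hΦ L hL
    rw [logNeg, h, T.traceNorm_AB1CB2_eq_ratio, ENNReal.log_ofReal_of_pos (pos1 T.ratio_pos)]
    simp only [h']
  have E2 {L : ℝ} (hL : 0 < L) : logNeg (reduceAB (rhoAB1CB2 (torusState (Φ L) ψ)))
      = (Real.log (∑ a, (‖ψ a‖ * X L a) ^ 2) : ℝ) := by
    obtain ⟨T, h, h'⟩ := hΦ L hL
    rw [logNeg, h, T.traceNorm_reduceAB_AB1CB2_eq_ratio,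
      ENNReal.log_ofReal_of_pos (pos2 T.ratio_pos)]
    simp only [h']
  have E3 {L : ℝ} (hL : 0 < L) : logNeg (rhoABCD (torusState (Φ L) ψ))
      = (Real.log (∑ a, ‖ψ a‖ ^ 2 * X L a) : ℝ) := by
    obtain ⟨T, h, h'⟩ := hΦ L hL
    rw [logNeg, h, T.traceNorm_ABCD_eq_ratio, ENNReal.log_ofReal_of_pos (pos3 T.ratio_pos)]
    simp only [h']
  have E4 (L : ℝ) (hL : 0 < L) : DisentanglingCondition (rhoABCD (torusState (Φ L) ψ)) := by
    obtain ⟨T, h, -⟩ := hΦ L hL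
    rw [h]
    exact T.disentanglingCondition_ABCD ψ
  have hT : Filter.Tendsto
        (fun L : ℝ => (logNeg (rhoAB1CB2 (torusState (Φ L) ψ))).toReal
          - (logNeg (reduceAB (rhoAB1CB2 (torusState (Φ L) ψ)))).toReal)
        Filter.atTop
        (nhds (Real.log ((∑ a, ‖ψ a‖ * d a) ^ 2 / ∑ a, ‖ψ a‖ ^ 2 * d a ^ 2))) := by
    have hcd (a : S) : 0 < c * d a := mul_pos hc (hd a)
    -- Numerator and denominator are homogeneous of degree two, so the common constant `c` drops out
    -- here and the common scale `g L` below.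
    have heq : (∑ a, ‖ψ a‖ * d a) ^ 2 / ∑ a, ‖ψ a‖ ^ 2 * d a ^ 2
        = (∑ a, ‖ψ a‖ * (c * d a)) ^ 2 / ∑ a, (‖ψ a‖ * (c * d a)) ^ 2 := by
      have h1 : ∑ a, ‖ψ a‖ * (c * d a) = c * ∑ a, ‖ψ a‖ * d a := by
        rw [Finset.mul_sum]
        exact Finset.sum_congr rfl fun a _ => by ring
      have h2 : ∑ a, (‖ψ a‖ * (c * d a)) ^ 2 = c ^ 2 * ∑ a, ‖ψ a‖ ^ 2 * d a ^ 2 := by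
        rw [Finset.mul_sum]
        exact Finset.sum_congr rfl fun a _ => by ring
      rw [h1, h2, mul_pow, mul_div_mul_left _ _ (by positivity)]
    have hl : Filter.Tendsto (fun L => Real.log ((∑ a, ‖ψ a‖ * (X L a / g L)) ^ 2 /
        ∑ a, (‖ψ a‖ * (X L a / g L)) ^ 2)) Filter.atTop
        (nhds (Real.log ((∑ a, ‖ψ a‖ * d a) ^ 2 / ∑ a, ‖ψ a‖ ^ 2 * d a ^ 2))) := by
      rw [heq]
      refine Filter.Tendsto.log ?_ (div_pos (pos1 hcd) (pos2 hcd)).ne'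
      refine Filter.Tendsto.div ?_ ?_ (pos2 hcd).ne'
      · exact (tendsto_finsetSum _ fun a _ => (hlim a).const_mul _).pow 2
      · exact tendsto_finsetSum _ fun a _ => ((hlim a).const_mul _).pow 2
    refine hl.congr' ?_
    filter_upwards [Filter.eventually_gt_atTop 0] with L hL
    rw [E1 hL, E2 hL, EReal.toReal_coe, EReal.toReal_coe,
      ← Real.log_div (pos1 (hX hL)).ne' (pos2 (hX hL)).ne']
    have hgL := hg L hL
    have h1 : ∑ a, ‖ψ a‖ * (X L a / g L) = (∑ a, ‖ψ a‖ * X L a) / g L := by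
      rw [Finset.sum_div]
      exact Finset.sum_congr rfl fun a _ => by ring
    have h2 : ∑ a, (‖ψ a‖ * (X L a / g L)) ^ 2 = (∑ a, (‖ψ a‖ * X L a) ^ 2) / g L ^ 2 := by
      rw [Finset.sum_div]
      exact Finset.sum_congr rfl fun a _ => by ring
    rw [h1, h2, div_pow, div_div_div_cancel_right₀ (by positivity)]
  refine ⟨fun L hL => ⟨_, _, _, _, E1 hL, E2 hL, E3 hL, (E4 L hL).symm.trans (E3 hL)⟩, hT,
    ?_, fun L hL => ?_, E4⟩
  · rw [← log_sq_sum_div_eq_zero_iff hψ hd]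
    constructor
    · exact fun h => tendsto_nhds_unique hT h
    · intro h
      rwa [h] at hT
  · rw [← sq_sum_eq_sum_sq_iff hψ (hX hL), DisentanglingCondition, E1 hL, E2 hL,
      EReal.coe_eq_coe_iff]
    exact Real.log_injOn_pos.eq_iff (pos1 (hX hL)) (pos2 (hX hL))

open Filter Topology

/-! ### Boson modes -/

/-- `∑_n exp(-h ∑_j (j+1) n_j)` over boson occupation numbers. -/
def bosonSum (h : ℝ) : ℝ := ∑' n : ℕ →₀ ℕ, Real.exp (-(n.sum fun j k => h * (j + 1) * k))

theorem summable_exp_neg_mul {h : ℝ} (hh : 0 < h) (s : ℝ) :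
    Summable fun j : ℕ => Real.exp (-(h * (j + s))) := by
  have h2 : Summable fun j : ℕ => Real.exp (-(h * s)) * Real.exp (-h) ^ j :=
    (summable_geometric_of_lt_one (Real.exp_nonneg _)
      (by rw [← Real.exp_zero]; exact Real.exp_lt_exp.2 (by linarith))).mul_left _
  refine h2.congr fun j => ?_
  rw [← Real.exp_nat_mul, ← Real.exp_add]
  congr 1
  ring

/-- An occupation function is encoded by its graph, a finite set of pairs `(j, k)` with `k ≠ 0`, and
its weight is a product over the graph. The sum is thus part of the expansion of `∏ (1 + f p)`,
which converges absolutely once `f` is summable. -/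
theorem summable_bosonSum {h : ℝ} (hh : 0 < h) :
    Summable fun n : ℕ →₀ ℕ => Real.exp (-(n.sum fun j k => h * (j + 1) * k)) := by
  classical
  let f : ℕ × ℕ → ℝ := fun p => if p.2 = 0 then 0 else Real.exp (-(h * (p.1 + 1) * p.2))
  have hf : Summable f := by
    have h1 := summable_exp_neg_mul hh 0
    refine Summable.of_nonneg_of_le (fun p => ?_) (fun p => ?_)
      (h1.mul_of_nonneg h1 (fun _ => Real.exp_nonneg _) (fun _ => Real.exp_nonneg _))
    · simp only [f]
      split_ifs
      · exact le_rfl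
      · exact Real.exp_nonneg _
    · obtain ⟨j, k⟩ := p
      simp only [f]
      split_ifs with hk
      · positivity
      · rw [← Real.exp_add]
        apply Real.exp_le_exp.2
        have hk' : (1 : ℝ) ≤ k := by exact_mod_cast Nat.one_le_iff_ne_zero.2 hk
        have hj : (0 : ℝ) ≤ j := Nat.cast_nonneg j
        -- For `k ≥ 1` one has `(j + 1) k ≥ j + k`, the difference being `j (k - 1)`.
        nlinarith [mul_nonneg hh.le (mul_nonneg hj (sub_nonneg.2 hk'))]
  have h2 := (summable_finsetProd_of_summable_norm hf.norm).comp_injective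
    (Finsupp.graph_injective ℕ ℕ)
  refine h2.congr fun n => ?_
  rw [Function.comp_apply, Finsupp.graph, Finset.prod_map, Finsupp.sum, ← Finset.sum_neg_distrib,
    Real.exp_sum]
  refine Finset.prod_congr rfl fun j hj => ?_
  exact if_neg (Finsupp.mem_support_iff.1 hj)

theorem bosonSum_pos {h : ℝ} (hh : 0 < h) : 0 < bosonSum h :=
  (summable_bosonSum hh).tsum_pos (fun _ => Real.exp_nonneg _) 0 (Real.exp_pos _)

/-! ### Winding numbers -/

/-- `∑_{n ∈ ℤ} exp(-t (n + c)²)` -/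
def windingSum (t c : ℝ) : ℝ := ∑' n : ℤ, Real.exp (-(t * (n + c) ^ 2))

/-- `∑_{n ≥ 0} exp(-t (n + c)²)` -/
def halfWindingSum (t c : ℝ) : ℝ := ∑' n : ℕ, Real.exp (-(t * (n + c) ^ 2))

theorem summable_halfWindingSum {t : ℝ} (ht : 0 < t) {c : ℝ} (hc : 0 ≤ c) :
    Summable fun n : ℕ => Real.exp (-(t * (n + c) ^ 2)) := by
  refine Summable.of_nonneg_of_le (fun n => Real.exp_nonneg _) (fun n => ?_)
    (summable_exp_neg_mul ht 0)
  apply Real.exp_le_exp.2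
  have h1 : (n : ℝ) ≤ (n : ℝ) ^ 2 := by
    rcases Nat.eq_zero_or_pos n with rfl | h
    · simp
    · have : (1 : ℝ) ≤ n := by exact_mod_cast h
      nlinarith
  have hn : (0 : ℝ) ≤ n := Nat.cast_nonneg n
  have h2 : (n : ℝ) + 0 ≤ (n + c) ^ 2 := by nlinarith [mul_nonneg hn hc, sq_nonneg c]
  nlinarith [mul_le_mul_of_nonneg_left h2 ht.le]

/-- Reflecting the negative integers `-(n + 1)` turns the offset `c` into `1 - c`. -/
theorem hasSum_windingSum_of_unit {t : ℝ} (ht : 0 < t) {c : ℝ} (hc : 0 ≤ c) (hc1 : c ≤ 1) :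
    HasSum (fun n : ℤ => Real.exp (-(t * (n + c) ^ 2)))
      (halfWindingSum t c + halfWindingSum t (1 - c)) := by
  refine HasSum.of_nat_of_neg_add_one (f := fun n : ℤ => Real.exp (-(t * (n + c) ^ 2))) ?_ ?_
  · exact_mod_cast (summable_halfWindingSum ht hc).hasSum
  · have h := (summable_halfWindingSum ht (sub_nonneg.2 hc1)).hasSum
    refine h.congr_fun fun n => ?_
    congr 2
    push_cast
    ring

theorem halfWindingSum_le {t : ℝ} (ht : 0 < t) {c : ℝ} (hc : 0 ≤ c) :
    halfWindingSum t c ≤ halfWindingSum t 0 := by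
  refine (summable_halfWindingSum ht hc).tsum_le_tsum (fun n => ?_)
    (summable_halfWindingSum ht le_rfl)
  apply Real.exp_le_exp.2
  have hn : (0 : ℝ) ≤ n := Nat.cast_nonneg n
  have : ((n : ℝ) + 0) ^ 2 ≤ (n + c) ^ 2 := by gcongr
  nlinarith [mul_le_mul_of_nonneg_left this ht.le]

/-- Dropping the first term, which equals `1`, moves the offset from `0` to `1`, and the half sum
decreases in the offset. -/
theorem le_halfWindingSum {t : ℝ} (ht : 0 < t) {c : ℝ} (hc : 0 ≤ c) (hc1 : c ≤ 1) :
    halfWindingSum t 0 - 1 ≤ halfWindingSum t c := by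
  have h := (summable_halfWindingSum ht le_rfl).tsum_eq_zero_add
  have h1 : halfWindingSum t 0 = 1 + halfWindingSum t 1 := by
    rw [halfWindingSum, h, halfWindingSum]
    simp
  have h2 : halfWindingSum t 1 ≤ halfWindingSum t c := by
    refine (summable_halfWindingSum ht zero_le_one).tsum_le_tsum (fun n => ?_)
      (summable_halfWindingSum ht hc)
    apply Real.exp_le_exp.2
    have hn : (0 : ℝ) ≤ n := Nat.cast_nonneg n
    have : ((n : ℝ) + c) ^ 2 ≤ (n + 1) ^ 2 := by gcongr
    nlinarith [mul_le_mul_of_nonneg_left this ht.le]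
  linarith

theorem hasSum_windingSum_fract {t : ℝ} (ht : 0 < t) (c : ℝ) :
    HasSum (fun n : ℤ => Real.exp (-(t * (n + c) ^ 2)))
      (halfWindingSum t (Int.fract c) + halfWindingSum t (1 - Int.fract c)) := by
  have h := hasSum_windingSum_of_unit ht (Int.fract_nonneg c) (Int.fract_lt_one c).le
  rw [← (Equiv.addRight ⌊c⌋).hasSum_iff] at h
  refine h.congr_fun fun n => ?_
  simp only [Function.comp_apply, Equiv.coe_addRight]
  congr 3
  push_cast
  rw [Int.fract]
  ring

theorem summable_windingSum {t : ℝ} (ht : 0 < t) (c : ℝ) :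
    Summable fun n : ℤ => Real.exp (-(t * (n + c) ^ 2)) :=
  (hasSum_windingSum_fract ht c).summable

theorem windingSum_pos {t : ℝ} (ht : 0 < t) (c : ℝ) : 0 < windingSum t c :=
  (summable_windingSum ht c).tsum_pos (fun _ => Real.exp_nonneg _) 0 (Real.exp_pos _)

/-- Each of the two half sums errs by at most `1`. The bound is uniform in `t`, while the half sum
at offset `0` diverges as `t → 0`; so the offset is asymptotically irrelevant. -/
theorem abs_windingSum_sub_le {t : ℝ} (ht : 0 < t) (c : ℝ) :
    |windingSum t c - 2 * halfWindingSum t 0| ≤ 2 := by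
  have h1 := Int.fract_nonneg c
  have h2 := (Int.fract_lt_one c).le
  have h3 : windingSum t c = _ := (hasSum_windingSum_fract ht c).tsum_eq
  have a1 := halfWindingSum_le ht h1
  have a2 := halfWindingSum_le ht (sub_nonneg.2 h2)
  have a3 := le_halfWindingSum ht h1 h2
  have a4 := le_halfWindingSum ht (sub_nonneg.2 h2) (by linarith)
  rw [abs_le]
  constructor <;> linarith

/-- The first `N` terms each tend to `1`, for every `N`. -/
theorem tendsto_halfWindingSum : Tendsto (fun t => halfWindingSum t 0) (𝓝[>] 0) atTop := by
  rw [tendsto_atTop]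
  intro b
  obtain ⟨N, hN⟩ := exists_nat_gt b
  have h1 : Tendsto (fun t : ℝ => ∑ n ∈ Finset.range N, Real.exp (-(t * ((n : ℝ) + 0) ^ 2)))
      (𝓝[>] 0) (𝓝 N) := by
    have : Continuous fun t : ℝ => ∑ n ∈ Finset.range N, Real.exp (-(t * ((n : ℝ) + 0) ^ 2)) := by
      fun_prop
    have h := this.tendsto 0
    simp only [zero_mul, neg_zero, Real.exp_zero, Finset.sum_const, Finset.card_range,
      nsmul_eq_mul, mul_one] at h
    exact h.mono_left nhdsWithin_le_nhds
  filter_upwards [h1.eventually_const_lt hN, self_mem_nhdsWithin] with t h ht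
  exact h.le.trans ((summable_halfWindingSum ht le_rfl).sum_le_tsum _ fun _ _ => Real.exp_nonneg _)

theorem tendsto_windingSum_div (c : ℝ) :
    Tendsto (fun t => windingSum t c / (2 * halfWindingSum t 0)) (𝓝[>] 0) (𝓝 1) := by
  have hT := tendsto_halfWindingSum.const_mul_atTop (two_pos (α := ℝ))
  have h0 : Tendsto (fun t => 2 / (2 * halfWindingSum t 0)) (𝓝[>] 0) (𝓝 0) :=
    hT.const_div_atTop 2
  rw [tendsto_iff_norm_sub_tendsto_zero]
  refine squeeze_zero' (Eventually.of_forall fun _ => norm_nonneg _) ?_ h0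
  filter_upwards [self_mem_nhdsWithin, hT.eventually_gt_atTop 0] with t ht hpos
  have h := abs_windingSum_sub_le ht c
  rw [Real.norm_eq_abs, div_sub_one hpos.ne', abs_div, abs_of_pos hpos]
  gcongr

/-! ### Fermion modes -/

/-- `∑_F exp(-h ∑_{j ∈ F} (j + s))` over finite sets of occupied fermion modes. -/
def fermionSum (h s : ℝ) : ℝ := ∑' F : Finset ℕ, ∏ j ∈ F, Real.exp (-(h * (j + s)))

theorem summable_fermionSum {h : ℝ} (hh : 0 < h) (s : ℝ) :
    Summable fun F : Finset ℕ => ∏ j ∈ F, Real.exp (-(h * (j + s))) :=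
  summable_finsetProd_of_summable_norm (summable_exp_neg_mul hh s).norm

theorem fermionSum_pos {h : ℝ} (hh : 0 < h) (s : ℝ) : 0 < fermionSum h s :=
  (summable_fermionSum hh s).tsum_pos (fun _ => Finset.prod_nonneg fun _ _ => Real.exp_nonneg _) ∅
    (by simp)

theorem tendsto_prod_fermionSum {h : ℝ} (hh : 0 < h) (s : ℝ) :
    Tendsto (fun n => ∏ j ∈ Finset.range n, (1 + Real.exp (-(h * (j + s))))) atTop
      (𝓝 (fermionSum h s)) :=
  (hasProd_one_add_of_hasSum_prod (summable_fermionSum hh s).hasSum).tendsto_prod_nat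

/-- In the product over modes the lowest factor splits off, and the rest is the product with offset
raised by one. -/
theorem fermionSum_eq_mul {h : ℝ} (hh : 0 < h) (s : ℝ) :
    fermionSum h s = (1 + Real.exp (-(h * s))) * fermionSum h (s + 1) := by
  refine tendsto_nhds_unique ((tendsto_prod_fermionSum hh s).comp (tendsto_add_atTop_nat 1)) ?_
  refine ((tendsto_prod_fermionSum hh (s + 1)).const_mul _).congr fun n => ?_
  rw [Function.comp_apply, Finset.prod_range_succ', mul_comm]
  congr 1
  · refine Finset.prod_congr rfl fun j _ => ?_
    congr 4
    push_cast
    ring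
  · simp

/-- Log-convexity in the offset of the modes. -/
theorem fermionSum_sq_le {h : ℝ} (hh : 0 < h) (s : ℝ) :
    fermionSum h (s + 1 / 2) ^ 2 ≤ fermionSum h s * fermionSum h (s + 1) := by
  refine le_of_tendsto_of_tendsto' ((tendsto_prod_fermionSum hh (s + 1 / 2)).pow 2)
    ((tendsto_prod_fermionSum hh s).mul (tendsto_prod_fermionSum hh (s + 1))) fun n => ?_
  rw [← Finset.prod_pow, ← Finset.prod_mul_distrib]
  refine Finset.prod_le_prod (fun j _ => sq_nonneg _) fun j _ => ?_
  -- With `x`, `y` the square roots of the outer factors, the claim for one mode is `(1 + xy)² ≤ (1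
  -- + x²)(1 + y²)`, that is `(x - y)² ≥ 0`.
  set x := Real.exp (-(h * (j + s)) / 2) with hx
  set y := Real.exp (-(h * (j + (s + 1))) / 2) with hy
  have h1 : Real.exp (-(h * (j + s))) = x ^ 2 := by
    rw [hx, ← Real.exp_nat_mul]
    congr 1
    push_cast
    ring
  have h2 : Real.exp (-(h * (j + (s + 1)))) = y ^ 2 := by
    rw [hy, ← Real.exp_nat_mul]
    congr 1
    push_cast
    ring
  have h3 : Real.exp (-(h * (j + (s + 1 / 2)))) = x * y := by
    rw [hx, hy, ← Real.exp_add]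
    congr 1
    ring
  rw [h1, h2, h3]
  nlinarith [sq_nonneg (x - y)]

/-- Write `F(s)` for `fermionSum h s`. Log-convexity at `1/2` with `F(0) = 2 F(1)` gives `F(1/2)² ≤
2 F(1)²`. Log-convexity at `1` with `F(1/2) = (1 + e^{-h/2}) F(3/2)` gives `(1 + e^{-h/2}) F(1)² ≤
F(1/2)²`. The squared ratio is squeezed to `2` without any modular identity. -/
theorem tendsto_fermionSum_div :
    Tendsto (fun h => fermionSum h 1 / fermionSum h (1 / 2)) (𝓝[>] 0) (𝓝 (1 / Real.sqrt 2)) := by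
  have hsq : Tendsto (fun h => (fermionSum h (1 / 2) / fermionSum h 1) ^ 2) (𝓝[>] 0) (𝓝 2) := by
    have hlow : Tendsto (fun h : ℝ => 1 + Real.exp (-(h * (1 / 2)))) (𝓝[>] 0) (𝓝 2) := by
      have : Continuous fun h : ℝ => 1 + Real.exp (-(h * (1 / 2))) := by fun_prop
      have h := this.tendsto 0
      simp only [zero_mul, neg_zero, Real.exp_zero, one_add_one_eq_two] at h
      exact h.mono_left nhdsWithin_le_nhds
    refine tendsto_of_tendsto_of_tendsto_of_le_of_le' hlow tendsto_const_nhds ?_ ?_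
    · filter_upwards [self_mem_nhdsWithin] with h hh
      have h1 := fermionSum_sq_le hh (1 / 2)
      have h2 := fermionSum_eq_mul hh (1 / 2)
      have h3 := fermionSum_pos hh 1
      have e : (1 / 2 + 1 / 2 : ℝ) = 1 := by norm_num
      rw [e] at h1
      rw [div_pow, le_div_iff₀ (by positivity)]
      calc _ ≤ (1 + Real.exp (-(h * (1 / 2)))) *
            (fermionSum h (1 / 2) * fermionSum h (1 / 2 + 1)) := by gcongr
        _ = fermionSum h (1 / 2) * ((1 + Real.exp (-(h * (1 / 2)))) *
            fermionSum h (1 / 2 + 1)) := by ring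
        _ = _ := by rw [← h2, sq]
    · filter_upwards [self_mem_nhdsWithin] with h hh
      have h1 := fermionSum_sq_le hh 0
      have h2 := fermionSum_eq_mul hh 0
      have h3 := fermionSum_pos hh 1
      rw [zero_add, zero_add] at h1
      simp only [mul_zero, neg_zero, Real.exp_zero, zero_add] at h2
      rw [div_pow, div_le_iff₀ (by positivity)]
      calc _ ≤ _ := h1
        _ = _ := by rw [h2]; ring
  have h1 := (hsq.sqrt).inv₀ (by positivity)
  rw [one_div (Real.sqrt 2)]
  refine h1.congr' ?_
  filter_upwards [self_mem_nhdsWithin] with h hh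
  have h2 := fermionSum_pos hh 1
  have h3 := fermionSum_pos hh (1 / 2)
  rw [Real.sqrt_sq (by positivity), inv_div]

/-- The part of the sum over winding numbers and fermion modes with even total parity. -/
def evenSum (t c h s : ℝ) : ℝ := ∑' p : ℤ × Finset ℕ, if Even (p.1 + p.2.card) then
  Real.exp (-(t * (p.1 + c) ^ 2)) * ∏ j ∈ p.2, Real.exp (-(h * (j + s))) else 0

theorem summable_winding_fermion {t h : ℝ} (ht : 0 < t) (hh : 0 < h) (c s : ℝ) :
    Summable fun p : ℤ × Finset ℕ =>
      Real.exp (-(t * (p.1 + c) ^ 2)) * ∏ j ∈ p.2, Real.exp (-(h * (j + s))) :=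
  (summable_windingSum ht c).mul_of_nonneg (summable_fermionSum hh s)
    (fun _ => Real.exp_nonneg _) (fun _ => Finset.prod_nonneg fun _ _ => Real.exp_nonneg _)

theorem tsum_winding_fermion {t h : ℝ} (ht : 0 < t) (hh : 0 < h) (c s : ℝ) :
    ∑' p : ℤ × Finset ℕ,
      Real.exp (-(t * (p.1 + c) ^ 2)) * ∏ j ∈ p.2, Real.exp (-(h * (j + s)))
      = windingSum t c * fermionSum h s :=
  ((summable_windingSum ht c).tsum_mul_tsum (summable_fermionSum hh s)
    (summable_winding_fermion ht hh c s)).symm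

/-- Toggle the occupation of the lowest fermion mode. -/
def toggleLowest : Equiv.Perm (Finset ℕ) :=
  Function.Involutive.toPerm (fun F => if 0 ∈ F then F.erase 0 else insert 0 F) fun F => by
    by_cases h : 0 ∈ F <;> simp [h]

theorem even_card_toggleLowest (n : ℤ) (F : Finset ℕ) :
    Even (n + ((toggleLowest F).card : ℤ)) ↔ ¬ Even (n + (F.card : ℤ)) := by
  change Even (n + ((if 0 ∈ F then F.erase 0 else insert 0 F : Finset ℕ).card : ℤ)) ↔ _
  split_ifs with h
  · rw [← Finset.card_erase_add_one h]
    push_cast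
    rw [← add_assoc, Int.even_add_one, not_not]
  · rw [Finset.card_insert_of_notMem h]
    push_cast
    rw [← add_assoc, Int.even_add_one]

/-- Filling mode `0` costs exactly the factor `x 0`; emptying it can only increase the product. -/
theorem prod_toggleLowest_ge {x : ℕ → ℝ} (hx : ∀ j, 0 ≤ x j) (h1 : x 0 ≤ 1) (F : Finset ℕ) :
    x 0 * ∏ j ∈ F, x j ≤ ∏ j ∈ toggleLowest F, x j := by
  change _ ≤ ∏ j ∈ (if 0 ∈ F then F.erase 0 else insert 0 F : Finset ℕ), x j
  split_ifs with h
  · rw [← Finset.mul_prod_erase F x h]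
    have h2 : 0 ≤ ∏ j ∈ F.erase 0, x j := Finset.prod_nonneg fun j _ => hx j
    have h0 := hx 0
    calc x 0 * (x 0 * ∏ j ∈ F.erase 0, x j) ≤ 1 * (1 * ∏ j ∈ F.erase 0, x j) := by gcongr
      _ = _ := by ring
  · rw [Finset.prod_insert h]

/-- The bijection `τ` exchanges `A` with its complement and loses at most a factor `ε`. -/
theorem mul_tsum_indicator_compl_le {P : Type} {f : P → ℝ} (hf : Summable f) (τ : P ≃ P) {ε : ℝ}
    (hτ : ∀ p, ε * f p ≤ f (τ p)) {A : Set P} (hA : ∀ p, τ p ∈ A ↔ p ∉ A) :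
    ε * ∑' p, Aᶜ.indicator f p ≤ ∑' p, A.indicator f p := by
  rw [← τ.tsum_eq (A.indicator f), ← tsum_mul_left]
  refine ((hf.indicator Aᶜ).mul_left ε).tsum_le_tsum (fun p => ?_)
    ((hf.indicator A).comp_injective τ.injective)
  by_cases hp : p ∈ A
  · have : τ p ∉ A := by rw [hA]; exact not_not.2 hp
    simp [hp, this]
  · have : τ p ∈ A := by rw [hA]; exact hp
    simpa [hp, this] using hτ p

/-- Toggling the lowest fermion mode exchanges even and odd parity, so the even part `x` and the odd
part `y` satisfy `ε y ≤ x` and `ε x ≤ y`, where `ε` is the weight of that mode. As `h → 0`, `ε → 1`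
and each part is half of the total. -/
theorem evenSum_bounds {t h s : ℝ} (ht : 0 < t) (hh : 0 < h) (c : ℝ) (hs : 0 ≤ s) :
    Real.exp (-(h * s)) / (1 + Real.exp (-(h * s))) * (windingSum t c * fermionSum h s)
        ≤ evenSum t c h s ∧
      evenSum t c h s ≤
        1 / (1 + Real.exp (-(h * s))) * (windingSum t c * fermionSum h s) := by
  set ε := Real.exp (-(h * s)) with hε
  have hε0 : 0 < ε := Real.exp_pos _
  let f : ℤ × Finset ℕ → ℝ := fun p =>
    Real.exp (-(t * (p.1 + c) ^ 2)) * ∏ j ∈ p.2, Real.exp (-(h * (j + s)))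
  have hf : Summable f := summable_winding_fermion ht hh c s
  have hf0 (p) : 0 ≤ f p :=
    mul_nonneg (Real.exp_nonneg _) (Finset.prod_nonneg fun _ _ => Real.exp_nonneg _)
  let A := {p : ℤ × Finset ℕ | Even (p.1 + (p.2.card : ℤ))}
  have hE : Summable (A.indicator f) := hf.indicator A
  have hO : Summable (Aᶜ.indicator f) := hf.indicator Aᶜ
  have hsum : ∑' p, A.indicator f p + ∑' p, Aᶜ.indicator f p = windingSum t c * fermionSum h s := by
    rw [← hE.tsum_add hO, ← tsum_winding_fermion ht hh c s]
    congr 1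
    ext1 p
    exact congrFun (Set.indicator_self_add_compl A f) p
  have hev : evenSum t c h s = ∑' p, A.indicator f p := by
    rw [evenSum]
    congr 1
    ext1 p
    rw [Set.indicator_apply]
    rfl
  let τ : ℤ × Finset ℕ ≃ ℤ × Finset ℕ := Equiv.prodCongr (Equiv.refl ℤ) toggleLowest
  have hτ (p) : ε * f p ≤ f (τ p) := by
    have h1 := prod_toggleLowest_ge (x := fun j => Real.exp (-(h * (j + s))))
      (fun j => Real.exp_nonneg _) (by
        simp only [Nat.cast_zero, zero_add]
        exact Real.exp_le_one_iff.2 (by nlinarith [mul_nonneg hh.le hs])) p.2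
    simp only [Nat.cast_zero, zero_add] at h1
    calc ε * f p = Real.exp (-(t * (p.1 + c) ^ 2)) *
        (ε * ∏ j ∈ p.2, Real.exp (-(h * (j + s)))) := by simp only [f]; ring
      _ ≤ _ := by
        refine mul_le_mul_of_nonneg_left h1 (Real.exp_nonneg _)
  have hmem (p) : τ p ∈ A ↔ p ∉ A := even_card_toggleLowest p.1 p.2
  have key1 := mul_tsum_indicator_compl_le hf τ hτ hmem
  have key2 := mul_tsum_indicator_compl_le (A := Aᶜ) hf τ hτ fun p => not_congr (hmem p)
  rw [compl_compl] at key2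
  rw [hev, ← hsum]
  generalize ∑' p, A.indicator f p = x at key1 key2
  generalize ∑' p, Aᶜ.indicator f p = y at key1 key2
  rw [div_mul_eq_mul_div, div_mul_eq_mul_div, div_le_iff₀ (by positivity),
    le_div_iff₀ (by positivity)]
  constructor <;> nlinarith

theorem evenSum_pos {t h s : ℝ} (ht : 0 < t) (hh : 0 < h) (c : ℝ) (hs : 0 ≤ s) :
    0 < evenSum t c h s := by
  have h1 := windingSum_pos ht c
  have h2 := fermionSum_pos hh s
  exact lt_of_lt_of_le (by positivity) (evenSum_bounds ht hh c hs).1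

theorem tendsto_evenSum_div {ι : Type} {l : Filter ι} {t h : ι → ℝ} (ht : Tendsto t l (𝓝[>] 0))
    (hh : Tendsto h l (𝓝[>] 0)) (c : ℝ) {s : ℝ} (hs : 0 ≤ s) :
    Tendsto (fun i => evenSum (t i) c (h i) s / (windingSum (t i) c * fermionSum (h i) s)) l
      (𝓝 (1 / 2)) := by
  have hε : Tendsto (fun i => Real.exp (-(h i * s))) l (𝓝 1) := by
    have : Continuous fun x : ℝ => Real.exp (-(x * s)) := by fun_prop
    have h1 := (this.tendsto 0).comp (hh.mono_right nhdsWithin_le_nhds)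
    simpa [Function.comp_def] using h1
  have h1 : Tendsto (fun i => Real.exp (-(h i * s)) / (1 + Real.exp (-(h i * s)))) l
      (𝓝 (1 / 2)) := by
    rw [show (1 / 2 : ℝ) = 1 / (1 + 1) by norm_num]
    exact hε.div (hε.const_add 1) (by norm_num)
  have h2 : Tendsto (fun i => 1 / (1 + Real.exp (-(h i * s)))) l (𝓝 (1 / 2)) := by
    rw [show (1 / 2 : ℝ) = 1 / (1 + 1) by norm_num]
    exact tendsto_const_nhds.div (hε.const_add 1) (by norm_num)
  have ev : ∀ᶠ i in l, 0 < t i ∧ 0 < h i :=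
    (ht.eventually self_mem_nhdsWithin).and (hh.eventually self_mem_nhdsWithin)
  refine tendsto_of_tendsto_of_tendsto_of_le_of_le' h1 h2 ?_ ?_
  · filter_upwards [ev] with i hi
    have := mul_pos (windingSum_pos hi.1 c) (fermionSum_pos hi.2 s)
    rw [le_div_iff₀ this]
    exact (evenSum_bounds hi.1 hi.2 c hs).1
  · filter_upwards [ev] with i hi
    have := mul_pos (windingSum_pos hi.1 c) (fermionSum_pos hi.2 s)
    rw [div_le_iff₀ this]
    exact (evenSum_bounds hi.1 hi.2 c hs).2

/-! ### Reduction of the ratios to first-power sums by scaling the circumference. -/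

theorem halfWindingSum_zero_pos {t : ℝ} (ht : 0 < t) : 0 < halfWindingSum t 0 :=
  (summable_halfWindingSum ht le_rfl).tsum_pos (fun _ => Real.exp_nonneg _) 0 (Real.exp_pos _)

theorem tendsto_const_div_nhdsGT_zero {c : ℝ} (hc : 0 < c) :
    Tendsto (fun L : ℝ => c / L) atTop (𝓝[>] 0) := by
  refine tendsto_nhdsWithin_iff.2 ⟨tendsto_const_nhds.div_atTop tendsto_id, ?_⟩
  filter_upwards [eventually_gt_atTop 0] with L hL
  exact div_pos hc hL

/-- Negativities of a family of glued torus states whose squared weights are the weights at half the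
circumference. -/
theorem negativity_of_scaling {S E K : Type} [Fintype S] (Φ : ℝ → S → (Fin 4 → K) → ℂ)
    (T : ∀ L : ℝ, 0 < L → GluedTorus S E K) (hΦ : ∀ L hL, Φ L = (T L hL).sectorState)
    (hsq : ∀ L hL a e, ‖(T L hL).weight a e‖ ^ 2 = ‖(T (L / 2) (half_pos hL)).weight a e‖)
    (N : ℝ → S → ℝ) (hN : ∀ L hL a, HasSum (fun e => ‖(T L hL).weight a e‖) (N L a))
    (d : S → ℝ) (hd : ∀ a, 0 < d a) (g : ℝ → ℝ) (hg : ∀ L, 0 < L → 0 < g L)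
    {c : ℝ} (hc : 0 < c)
    (hlim : ∀ a, Tendsto (fun L => N L a / g L) atTop (𝓝 (c * d a)))
    (ψ : S → ℂ) (hψ : ∑ a, ‖ψ a‖ ^ 2 = 1) :
    (∀ L : ℝ, 0 < L → ∃ e₁ e₂ e₃ e₄ : ℝ,
        logNeg (rhoAB1CB2 (torusState (Φ L) ψ)) = (e₁ : EReal) ∧
        logNeg (reduceAB (rhoAB1CB2 (torusState (Φ L) ψ))) = (e₂ : EReal) ∧
        logNeg (rhoABCD (torusState (Φ L) ψ)) = (e₃ : EReal) ∧
        logNeg (reduceAB (rhoABCD (torusState (Φ L) ψ))) = (e₄ : EReal)) ∧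
      Filter.Tendsto
        (fun L : ℝ => (logNeg (rhoAB1CB2 (torusState (Φ L) ψ))).toReal
          - (logNeg (reduceAB (rhoAB1CB2 (torusState (Φ L) ψ)))).toReal)
        Filter.atTop
        (nhds (Real.log ((∑ a, ‖ψ a‖ * d a) ^ 2 / ∑ a, ‖ψ a‖ ^ 2 * d a ^ 2))) ∧
      (Filter.Tendsto
        (fun L : ℝ => (logNeg (rhoAB1CB2 (torusState (Φ L) ψ))).toReal
          - (logNeg (reduceAB (rhoAB1CB2 (torusState (Φ L) ψ)))).toReal)
        Filter.atTop (nhds 0) ↔ InSingleSector ψ) ∧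
      (∀ L : ℝ, 0 < L →
        (DisentanglingCondition (rhoAB1CB2 (torusState (Φ L) ψ)) ↔ InSingleSector ψ)) ∧
      (∀ L : ℝ, 0 < L → DisentanglingCondition (rhoABCD (torusState (Φ L) ψ))) := by
  have h1 (L hL a) : ((T L hL).norm1 a : ℝ) = N L a := by
    rw [← (hN L hL a).tsum_eq, GluedTorus.norm1, NNReal.coe_tsum]
    rfl
  have h2 (L hL a) : ((T L hL).norm2 a : ℝ) = N (L / 2) a := by
    rw [← (hN _ (half_pos hL) a).tsum_eq, GluedTorus.norm2, NNReal.coe_tsum]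
    simp only [← hsq L hL]
    rfl
  -- The scale is transformed in the same way as the sums, so the limit becomes `(c d_a)² / (c d_a)
  -- = c d_a`: the quantum dimension survives to the first power.
  refine negativity_of_gluedTorus Φ (fun L a => N L a ^ 2 / N (L / 2) a)
    (fun L hL => ⟨T L hL, hΦ L hL, fun a => ?_⟩) d hd (fun L => g L ^ 2 / g (L / 2))
    (fun L hL => div_pos (pow_pos (hg L hL) 2) (hg _ (half_pos hL))) hc (fun a => ?_) ψ hψ
  · rw [GluedTorus.ratio, h1, h2]
  · have hne : c * d a ≠ 0 := (mul_pos hc (hd a)).ne'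
    have hhalf : Tendsto (fun L : ℝ => L / 2) atTop atTop :=
      tendsto_id.atTop_div_const two_pos
    have h := ((hlim a).pow 2).div ((hlim a).comp hhalf) hne
    rw [sq, mul_div_assoc, div_self hne, mul_one] at h
    refine h.congr fun L => ?_
    simp only [Pi.div_apply, Function.comp_apply, div_pow]
    rw [div_div_div_comm]

theorem exists_ne_zero_of_hasSum {E : Type} {f : E → ℂ} {x : ℝ} (h : HasSum (fun e => ‖f e‖) x)
    (hx : 0 < x) : ∃ e, f e ≠ 0 := by
  by_contra! h0
  simp only [h0, norm_zero] at h
  exact hx.ne (hasSum_zero.unique h)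

theorem hasSum_mul_of_nonneg {α β : Type} {f : α → ℝ} {g : β → ℝ} {x y : ℝ} (hf : HasSum f x)
    (hg : HasSum g y) (hf0 : ∀ a, 0 ≤ f a) (hg0 : ∀ b, 0 ≤ g b) :
    HasSum (fun p : α × β => f p.1 * g p.2) (x * y) :=
  hf.mul hg (hf.summable.mul_of_nonneg hg.summable hf0 hg0)

/-! ### Laughlin states -/

/-- The logarithm of the Laughlin weight in units of `-1/L`. -/
def laughlinEnergy (m : ℕ) (v : ℝ) (e : LaughlinEdge) : ℝ :=
  v * Real.pi * m / 2 * (e.winding : ℝ) ^ 2 + e.boson.sum fun j n => v * Real.pi * (j + 1) * n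

theorem laughlinWeight_eq (m : ℕ) (v L : ℝ) (e : LaughlinEdge) :
    laughlinWeight m v L e = Real.exp (-(laughlinEnergy m v e / L)) := by
  rw [laughlinWeight, laughlinEnergy, add_div, Finsupp.sum, Finsupp.sum, Finset.sum_div, neg_add]
  congr 1
  rw [sub_eq_add_neg]
  congr 1
  · ring
  · congr 1
    refine Finset.sum_congr rfl fun j _ => ?_
    ring

theorem exp_neg_div_sq (x L : ℝ) :
    Real.exp (-(x / L)) ^ 2 = Real.exp (-(x / (L / 2))) := by
  rw [← Real.exp_nat_mul]
  congr 1
  push_cast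
  rw [div_div_eq_mul_div]
  ring

open Classical in
theorem norm_laughlinInterface (m : ℕ) (v L : ℝ) (a : Fin m) (e : LaughlinEdge) :
    ‖laughlinInterface m v L a e‖ = if ∃ n : ℤ, e.winding = (n : ℚ) - (a : ℕ) / (m : ℚ)
      then Real.exp (-(laughlinEnergy m v e / L)) else 0 := by
  rw [laughlinInterface]
  split_ifs
  · rw [laughlinWeight_eq, Complex.norm_real, Real.norm_eq_abs, Real.abs_exp]
  · simp

theorem hasSum_laughlinInterface {m : ℕ} (hm : 0 < m) {v L : ℝ} (hv : 0 < v) (hL : 0 < L)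
    (a : Fin m) : HasSum (fun e => ‖laughlinInterface m v L a e‖)
      (windingSum (v * Real.pi * m / 2 / L) (-((a : ℕ) / (m : ℝ))) *
        bosonSum (v * Real.pi / L)) := by
  classical
  have hπ := Real.pi_pos
  have hm' : (0 : ℝ) < m := by exact_mod_cast hm
  let G : ℤ × (ℕ →₀ ℕ) → LaughlinEdge := fun p => ⟨(p.1 : ℚ) - (a : ℕ) / (m : ℚ), p.2⟩
  have hG : Function.Injective G := by
    rintro ⟨n, b⟩ ⟨n', b'⟩ h
    simpa [G] using h
  rw [← hG.hasSum_iff]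
  · have hs1 := summable_windingSum (t := v * Real.pi * m / 2 / L) (by positivity)
      (-((a : ℕ) / (m : ℝ)))
    have hs2 := summable_bosonSum (h := v * Real.pi / L) (by positivity)
    refine (hasSum_mul_of_nonneg hs1.hasSum hs2.hasSum (fun _ => Real.exp_nonneg _)
      (fun _ => Real.exp_nonneg _)).congr_fun fun p => ?_
    rw [Function.comp_apply, norm_laughlinInterface, if_pos ⟨p.1, rfl⟩, ← Real.exp_add,
      laughlinEnergy, Finsupp.sum, Finsupp.sum, ← neg_add]
    congr 2
    rw [add_div, Finset.sum_div]
    congr 1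
    · simp only [G]
      push_cast
      ring
    · refine Finset.sum_congr rfl fun j _ => ?_
      ring
  · intro e he
    rw [norm_laughlinInterface, if_neg]
    rintro ⟨n, hn⟩
    exact he ⟨(n, e.boson), by cases e; simp_all [G]⟩

/-- The winding number determines `a` modulo `m`, and both labels lie in `[0, m)`. -/
theorem laughlinInterface_disjoint {m : ℕ} (hm : 0 < m) {v L : ℝ} (a b : Fin m) (e : LaughlinEdge)
    (ha : laughlinInterface m v L a e ≠ 0) (hb : laughlinInterface m v L b e ≠ 0) : a = b := by
  classical
  simp only [laughlinInterface, ne_eq, ite_eq_right_iff, not_forall] at ha hb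
  obtain ⟨⟨n, hn⟩, -⟩ := ha
  obtain ⟨⟨k, hk⟩, -⟩ := hb
  rw [hn] at hk
  have hm' : (m : ℚ) ≠ 0 := by exact_mod_cast hm.ne'
  field_simp at hk
  have hk' : n * (m : ℤ) - (a : ℕ) = m * k - (b : ℕ) := by exact_mod_cast hk
  have h1 := a.2
  have h2 := b.2
  have h3 : ((a : ℕ) : ℤ) - (b : ℕ) = m * (n - k) := by linarith
  have h4 : ((a : ℕ) : ℤ) - (b : ℕ) = 0 :=
    Int.eq_zero_of_abs_lt_dvd ⟨_, h3⟩ (by rw [abs_lt]; constructor <;> omega)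
  ext
  omega

/-- The Laughlin torus as a gluing of cylinders. -/
def laughlinTorus {m : ℕ} (hm : 0 < m) {v : ℝ} (hv : 0 < v) (L : ℝ) (hL : 0 < L) :
    GluedTorus (Fin m) LaughlinEdge LaughlinCyl where
  left := LaughlinCyl.left
  right := LaughlinCyl.right
  cyl _ e e' := ⟨e, e'⟩
  left_cyl _ _ _ := rfl
  right_cyl _ _ _ := rfl
  weight := laughlinInterface m v L
  coeff _ := 1
  coeff_ne _ := one_ne_zero
  weight_disjoint a b e := laughlinInterface_disjoint hm a b e
  exists_weight a := by
    have hπ := Real.pi_pos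
    have hm' : (0 : ℝ) < m := by exact_mod_cast hm
    exact exists_ne_zero_of_hasSum (hasSum_laughlinInterface hm hv hL a)
      (mul_pos (windingSum_pos (by positivity) _) (bosonSum_pos (by positivity)))
  weight_summable a := (hasSum_laughlinInterface hm hv hL a).summable

theorem laughlinSectorState_eq {m : ℕ} (hm : 0 < m) {v : ℝ} (hv : 0 < v) (L : ℝ) (hL : 0 < L) :
    laughlinSectorState m v L = (laughlinTorus hm hv L hL).sectorState := by
  ext a x
  rw [laughlinSectorState, GluedTorus.sectorState]
  have h : (∀ i, (x i).right = (x (i + 1)).left) ↔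
      ∀ i, x i = (laughlinTorus hm hv L hL).cyl i ((laughlinTorus hm hv L hL).left (x i))
        ((laughlinTorus hm hv L hL).left (x (i + 1))) := by
    refine forall_congr' fun i => ?_
    change _ ↔ x i = ⟨(x i).left, (x (i + 1)).left⟩
    rcases x i with ⟨l, r⟩
    simp
  by_cases hx : ∀ i, (x i).right = (x (i + 1)).left
  · rw [if_pos hx, if_pos (h.1 hx)]
    simp [laughlinTorus]
  · rw [if_neg hx, if_neg (mt h.2 hx)]

theorem tendsto_laughlin {m : ℕ} (hm : 0 < m) {v : ℝ} (hv : 0 < v) (c : ℝ) :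
    Tendsto (fun L : ℝ => windingSum (v * Real.pi * m / 2 / L) c * bosonSum (v * Real.pi / L) /
      (2 * halfWindingSum (v * Real.pi * m / 2 / L) 0 * bosonSum (v * Real.pi / L)))
      atTop (𝓝 1) := by
  have hπ := Real.pi_pos
  have hm' : (0 : ℝ) < m := by exact_mod_cast hm
  refine ((tendsto_windingSum_div c).comp (tendsto_const_div_nhdsGT_zero
    (c := v * Real.pi * m / 2) (by positivity))).congr' ?_
  filter_upwards [eventually_gt_atTop 0] with L hL
  rw [Function.comp_apply, mul_div_mul_right _ _ (bosonSum_pos (by positivity)).ne']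

/-! ### Moore-Read states -/

/-- The logarithm of the Moore-Read weight in units of `-1/L`. -/
def mrEnergy (m : ℕ) (v w : ℝ) (e : MREdge) : ℝ :=
  v * Real.pi * m / 2 * (e.winding : ℝ) ^ 2 + (e.boson.sum fun j n => v * Real.pi * (j + 1) * n)
    + ∑ j ∈ e.fermion, w * Real.pi * (j + if e.twisted then 1 else 1 / 2)

theorem mrWeight_eq (m : ℕ) (v w L : ℝ) (e : MREdge) :
    mrWeight m v w L e = Real.exp (-(mrEnergy m v w e / L)) := by
  rw [mrWeight, mrEnergy, add_div, add_div, Finsupp.sum, Finsupp.sum, Finset.sum_div,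
    Finset.sum_div, neg_add, neg_add]
  congr 1
  rw [sub_eq_add_neg, sub_eq_add_neg]
  congr 1
  · congr 1
    · ring
    · congr 1
      refine Finset.sum_congr rfl fun j _ => ?_
      ring
  · congr 1
    refine Finset.sum_congr rfl fun j _ => ?_
    rw [mrFermionMomentum]
    ring

theorem one_add_neg_one_zpow_div_two (k : ℤ) :
    (1 + (-1 : ℂ) ^ k) / 2 = if Even k then 1 else 0 := by
  split_ifs with h
  · rw [h.neg_one_zpow]
    norm_num
  · rw [(Int.not_even_iff_odd.1 h).neg_one_zpow]
    norm_num

/-- The parity condition on an edge in sector `a`, void in a twisted sector. -/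
def MREdgeEven (m : ℕ) (a : MRSector m) (e : MREdge) : Prop :=
  mrTwisted m a = false → Even (⌊e.winding - mrCharge m a / (m : ℚ)⌋ + (e.fermion.card : ℤ))

open Classical in
/-- The interface weights, including the projections at the edges in an untwisted sector. -/
def mrEdgeWeight (m : ℕ) (v w L : ℝ) (a : MRSector m) (e : MREdge) : ℂ :=
  if MREdgeEven m a e then mrInterface m v w L a e else 0

open Classical in
theorem norm_mrEdgeWeight (m : ℕ) (v w L : ℝ) (a : MRSector m) (e : MREdge) :
    ‖mrEdgeWeight m v w L a e‖ = if MREdgeEven m a e ∧ e.twisted = mrTwisted m a ∧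
      ∃ n : ℤ, e.winding = (n : ℚ) + mrCharge m a / (m : ℚ)
      then Real.exp (-(mrEnergy m v w e / L)) else 0 := by
  rw [mrEdgeWeight, mrInterface]
  by_cases h1 : MREdgeEven m a e
  swap
  · simp [h1]
  by_cases h2 : e.twisted = mrTwisted m a ∧
      ∃ n : ℤ, e.winding = (n : ℚ) + mrCharge m a / (m : ℚ)
  swap
  · rw [if_pos h1, if_neg h2, if_neg (fun h => h2 h.2), norm_zero]
  · rw [if_pos h1, if_pos h2, if_pos ⟨h1, h2⟩, mrWeight_eq, norm_mul, norm_pow,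
      Complex.norm_I, one_pow, one_mul, Complex.norm_real,
      Real.norm_eq_abs, Real.abs_exp]

/-- The sum of the interface weights of sector `a`. -/
def mrEdgeSum (m : ℕ) (v w L : ℝ) (a : MRSector m) : ℝ :=
  (if mrTwisted m a then windingSum (v * Real.pi * m / 2 / L) ((mrCharge m a / m : ℚ) : ℝ) *
      fermionSum (w * Real.pi / L) 1
    else evenSum (v * Real.pi * m / 2 / L) ((mrCharge m a / m : ℚ) : ℝ) (w * Real.pi / L) (1 / 2))
    * bosonSum (v * Real.pi / L)

theorem mrEdgeSum_pos {m : ℕ} (hm : 0 < m) {v w L : ℝ} (hv : 0 < v) (hw : 0 < w) (hL : 0 < L)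
    (a : MRSector m) : 0 < mrEdgeSum m v w L a := by
  have hπ := Real.pi_pos
  have hm' : (0 : ℝ) < m := by exact_mod_cast hm
  refine mul_pos ?_ (bosonSum_pos (by positivity))
  split_ifs
  · exact mul_pos (windingSum_pos (by positivity) _) (fermionSum_pos (by positivity) _)
  · exact evenSum_pos (by positivity) (by positivity) _ (by norm_num)

theorem hasSum_mrEdgeWeight {m : ℕ} (hm : 0 < m) {v w L : ℝ} (hv : 0 < v) (hw : 0 < w) (hL : 0 < L)
    (a : MRSector m) :
    HasSum (fun e => ‖mrEdgeWeight m v w L a e‖) (mrEdgeSum m v w L a) := by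
  classical
  have hπ := Real.pi_pos
  have hm' : (0 : ℝ) < m := by exact_mod_cast hm
  have ht : 0 < v * Real.pi * m / 2 / L := by positivity
  have hh : 0 < w * Real.pi / L := by positivity
  let G : (ℤ × Finset ℕ) × (ℕ →₀ ℕ) → MREdge := fun p =>
    ⟨mrTwisted m a, (p.1.1 : ℚ) + mrCharge m a / (m : ℚ), p.2, p.1.2⟩
  have hG : Function.Injective G := by
    rintro ⟨⟨n, F⟩, b⟩ ⟨⟨n', F'⟩, b'⟩ h
    simp only [G, MREdge.mk.injEq, add_left_inj, Int.cast_inj, true_and] at h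
    rw [h.1, h.2.1, h.2.2]
  have hGv (p) : ‖mrEdgeWeight m v w L a (G p)‖
      = (if mrTwisted m a = false → Even (p.1.1 + (p.1.2.card : ℤ)) then
          Real.exp (-(v * Real.pi * m / 2 / L * (p.1.1 + ((mrCharge m a / m : ℚ) : ℝ)) ^ 2)) *
          ∏ j ∈ p.1.2, Real.exp (-(w * Real.pi / L * (j + if mrTwisted m a then 1 else 1 / 2)))
          else 0) *
        Real.exp (-(p.2.sum fun j k => v * Real.pi / L * (j + 1) * k)) := by
    rw [norm_mrEdgeWeight]
    have hE : (MREdgeEven m a (G p) ∧ (G p).twisted = mrTwisted m a ∧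
        ∃ n : ℤ, (G p).winding = (n : ℚ) + mrCharge m a / (m : ℚ)) ↔
        (mrTwisted m a = false → Even (p.1.1 + (p.1.2.card : ℤ))) := by
      simp [MREdgeEven, G]
    simp only [hE]
    by_cases h1 : mrTwisted m a = false → Even (p.1.1 + (p.1.2.card : ℤ))
    · rw [if_pos h1, if_pos h1, ← Real.exp_sum, ← Real.exp_add, ← Real.exp_add,
        mrEnergy, Finsupp.sum, Finsupp.sum]
      congr 1
      rw [add_div, add_div, Finset.sum_div, Finset.sum_div, neg_add, neg_add,
        Finset.sum_neg_distrib]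
      simp only [G]
      push_cast
      have e1 : ∑ j ∈ p.1.2, w * Real.pi * (j + if mrTwisted m a then (1 : ℝ) else 1 / 2) / L
          = ∑ j ∈ p.1.2, w * Real.pi / L * (j + if mrTwisted m a then (1 : ℝ) else 1 / 2) :=
        Finset.sum_congr rfl fun j _ => by ring
      have e2 : ∑ j ∈ p.2.support, v * Real.pi * ((j : ℝ) + 1) * (p.2 j : ℝ) / L
          = ∑ j ∈ p.2.support, v * Real.pi / L * ((j : ℝ) + 1) * (p.2 j : ℝ) :=
        Finset.sum_congr rfl fun j _ => by ring
      rw [e1, e2]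
      ring
    · rw [if_neg h1, if_neg h1, zero_mul]
  rw [← hG.hasSum_iff]
  · have hs2 := summable_bosonSum (h := v * Real.pi / L) (by positivity)
    have hs1 (s : ℝ) := summable_winding_fermion ht hh ((mrCharge m a / m : ℚ) : ℝ) s
    rw [mrEdgeSum]
    by_cases hta : mrTwisted m a = true
    · rw [if_pos hta, ← tsum_winding_fermion ht hh]
      refine (hasSum_mul_of_nonneg (hs1 1).hasSum hs2.hasSum
        (fun _ => mul_nonneg (Real.exp_nonneg _)
          (Finset.prod_nonneg fun _ _ => Real.exp_nonneg _))
        (fun _ => Real.exp_nonneg _)).congr_fun fun p => ?_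
      rw [Function.comp_apply, hGv, if_pos (by simp [hta])]
      simp only [hta, if_true]
    · have hta' : mrTwisted m a = false := by simpa using hta
      have hs3 : HasSum (fun p : ℤ × Finset ℕ => if Even (p.1 + (p.2.card : ℤ)) then
          Real.exp (-(v * Real.pi * m / 2 / L * (p.1 + ((mrCharge m a / m : ℚ) : ℝ)) ^ 2)) *
          ∏ j ∈ p.2, Real.exp (-(w * Real.pi / L * (j + 1 / 2))) else 0)
          (evenSum (v * Real.pi * m / 2 / L) ((mrCharge m a / m : ℚ) : ℝ)
            (w * Real.pi / L) (1 / 2)) := by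
        refine Summable.hasSum (((hs1 (1 / 2)).indicator
          {p | Even (p.1 + (p.2.card : ℤ))}).congr fun p => ?_)
        rw [Set.indicator_apply]
        rfl
      rw [if_neg hta]
      refine (hasSum_mul_of_nonneg hs3 hs2.hasSum (fun p => ?_)
        (fun _ => Real.exp_nonneg _)).congr_fun fun p => ?_
      · split_ifs
        · exact mul_nonneg (Real.exp_nonneg _) (Finset.prod_nonneg fun _ _ => Real.exp_nonneg _)
        · exact le_rfl
      · rw [Function.comp_apply, hGv]
        by_cases hp : Even (p.1.1 + (p.1.2.card : ℤ))
        · rw [if_pos fun _ => hp, if_pos hp]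
          simp only [hta', Bool.false_eq_true, if_false]
        · rw [if_neg fun h => hp (h hta'), if_neg hp]
  · intro e he
    rw [norm_mrEdgeWeight, if_neg]
    rintro ⟨-, ht, n, hn⟩
    exact he ⟨((n, e.fermion), e.boson), by cases e; simp_all [G]⟩

theorem exists_of_mrEdgeWeight_ne {m : ℕ} {v w L : ℝ} {a : MRSector m} {e : MREdge}
    (h : mrEdgeWeight m v w L a e ≠ 0) : MREdgeEven m a e ∧ e.twisted = mrTwisted m a ∧
      ∃ n : ℤ, e.winding = (n : ℚ) + mrCharge m a / (m : ℚ) := by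
  classical
  rw [← norm_ne_zero_iff, norm_mrEdgeWeight] at h
  simp only [ne_eq, ite_eq_right_iff, not_forall] at h
  exact h.1

/-- The boundary condition separates twisted from untwisted sectors and the winding number
determines `r`. Only `I^r` and `χ^r` share a winding lattice, and they are told apart by the parity
projection. -/
theorem mrEdgeWeight_disjoint {m : ℕ} (hm : 0 < m) {v w L : ℝ} (a b : MRSector m) (e : MREdge)
    (ha : mrEdgeWeight m v w L a e ≠ 0) (hb : mrEdgeWeight m v w L b e ≠ 0) : a = b := by
  obtain ⟨ea, ta, n, hn⟩ := exists_of_mrEdgeWeight_ne ha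
  obtain ⟨eb, tb, k, hk⟩ := exists_of_mrEdgeWeight_ne hb
  have htw := ta.symm.trans tb
  have hm' : (m : ℚ) ≠ 0 := by exact_mod_cast hm.ne'
  have hfa : ⌊e.winding - mrCharge m a / (m : ℚ)⌋ = n := by rw [hn]; simp
  have hfb : ⌊e.winding - mrCharge m b / (m : ℚ)⌋ = k := by rw [hk]; simp
  rw [MREdgeEven, hfa] at ea
  rw [MREdgeEven, hfb] at eb
  rw [hn] at hk
  field_simp at hk
  have main (r s : Fin m) (j : ℤ) (h : ((r : ℕ) : ℤ) - (s : ℕ) = m * j) : r = s ∧ j = 0 := by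
    have h1 := r.2
    have h2 := s.2
    have h4 : ((r : ℕ) : ℤ) - (s : ℕ) = 0 :=
      Int.eq_zero_of_abs_lt_dvd ⟨_, h⟩ (by rw [abs_lt]; constructor <;> omega)
    refine ⟨by ext; omega, ?_⟩
    rw [h4] at h
    have : (m : ℤ) ≠ 0 := by exact_mod_cast hm.ne'
    exact (mul_eq_zero.1 h.symm).resolve_left this
  rcases a with (r | r) | r <;> rcases b with (s | s) | s <;>
    simp only [mrTwisted, Bool.false_eq_true, Bool.true_eq_false, true_imp_iff] at htw ea eb <;>
    simp only [mrCharge] at hk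
  · have hk' : n * (m : ℤ) + (r : ℕ) = m * k + (s : ℕ) := by exact_mod_cast hk
    rw [(main r s (k - n) (by linarith)).1]
  · have hk' : n * (m : ℤ) + (r : ℕ) = m * k + ((s : ℕ) + m) := by exact_mod_cast hk
    -- Here `k = n - 1`: the charges differ by `m`, the integer parts by one, and the two parity
    -- conditions on the same fermion number contradict each other.
    have := (main r s (k - n + 1) (by linarith)).2
    obtain ⟨x, hx⟩ := ea
    obtain ⟨y, hy⟩ := eb
    omega
  · have hk' : n * (m : ℤ) + ((r : ℕ) + m) = m * k + (s : ℕ) := by exact_mod_cast hk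
    have := (main r s (k - n - 1) (by linarith)).2
    obtain ⟨x, hx⟩ := ea
    obtain ⟨y, hy⟩ := eb
    omega
  · have hk' : n * (m : ℤ) + ((r : ℕ) + m) = m * k + ((s : ℕ) + m) := by exact_mod_cast hk
    rw [(main r s (k - n) (by linarith)).1]
  · have hk' : n * (m : ℤ) + (r : ℕ) = m * k + (s : ℕ) := by
      have : n * (m : ℚ) + (r : ℕ) = m * k + (s : ℕ) := by linarith
      exact_mod_cast this
    rw [(main r s (k - n) (by linarith)).1]

/-- The fermion parity of a cylinder, up to its zero modes. -/
def mrCylParity (i : Fin 4) (e e' : MREdge) : ℤ :=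
  ⌊e'.winding - e.winding⌋ + (e.fermion.card : ℤ) + (e'.fermion.card : ℤ) + if i = 3 then 1 else 0

/-- The occupation of the zero modes of a cylinder, as fixed by its edges. -/
def mrCylZero (i : Fin 4) (e e' : MREdge) : Fin 2 :=
  if e.twisted then if Even (mrCylParity i e e') then 0 else 1 else 0

theorem even_mrCylParity_add_iff {i : Fin 4} {e e' : MREdge} (he : e.twisted = true) (z : Fin 2) :
    Even (mrCylParity i e e' + ((z : ℕ) : ℤ)) ↔ z = mrCylZero i e e' := by
  rw [mrCylZero, if_pos he]
  split_ifs with h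
  · fin_cases z
    · simpa using h
    · simpa [Int.even_add_one] using h
  · fin_cases z
    · simpa using h
    · simpa [Int.even_add_one] using h

/-- The amplitude of the zero modes in sector `a`. -/
def mrCoeff (m : ℕ) (a : MRSector m) : ℂ :=
  if mrTwisted m a then ((1 / Real.sqrt (2 ^ 3) : ℝ) : ℂ) else 1

/-- The Moore-Read torus as a gluing of cylinders. -/
def mrTorus {m : ℕ} (hm : 0 < m) {v w : ℝ} (hv : 0 < v) (hw : 0 < w) (L : ℝ) (hL : 0 < L) :
    GluedTorus (MRSector m) MREdge MRCyl where
  left := MRCyl.left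
  right := MRCyl.right
  cyl i e e' := ⟨e, e', mrCylZero i e e'⟩
  left_cyl _ _ _ := rfl
  right_cyl _ _ _ := rfl
  weight := mrEdgeWeight m v w L
  coeff := mrCoeff m
  coeff_ne a := by
    rw [mrCoeff]
    split_ifs
    · exact Complex.ofReal_ne_zero.2 (by positivity)
    · exact one_ne_zero
  weight_disjoint a b e := mrEdgeWeight_disjoint hm a b e
  exists_weight a := exists_ne_zero_of_hasSum (hasSum_mrEdgeWeight hm hv hw hL a)
    (mrEdgeSum_pos hm hv hw hL a)
  weight_summable a := (hasSum_mrEdgeWeight hm hv hw hL a).summable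

theorem mrEdgeProj_mul_mrInterface {m : ℕ} {v w L : ℝ} {a : MRSector m}
    (ha : mrTwisted m a = false) (e : MREdge) :
    mrEdgeProj m a e * mrInterface m v w L a e = mrEdgeWeight m v w L a e := by
  rw [mrEdgeProj, one_add_neg_one_zpow_div_two, mrEdgeWeight]
  simp [MREdgeEven, ha]

/-- Each interface is seen by the two cylinders it joins, so its projection occurs twice; its
eigenvalues are `0` and `1`, hence it is idempotent. -/
theorem prod_mrCylProj_untwisted {m : ℕ} {a : MRSector m} (ha : mrTwisted m a = false)
    {x : Fin 4 → MRCyl} (hx : ∀ i, (x i).right = (x (i + 1)).left) :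
    ∏ i, mrCylProj m a i (x i) = ∏ i, mrEdgeProj m a (x i).left := by
  have h1 (i : Fin 4) : mrCylProj m a i (x i)
      = mrEdgeProj m a (x i).left * mrEdgeProj m a (x (i + 1)).left := by
    simp [mrCylProj, ha, hx i]
  simp only [h1]
  have h2 : ∏ i, mrEdgeProj m a (x (i + 1)).left = ∏ i, mrEdgeProj m a (x i).left :=
    Equiv.prod_comp (Equiv.addRight (1 : Fin 4)) fun i => mrEdgeProj m a (x i).left
  rw [Finset.prod_mul_distrib, h2, ← Finset.prod_mul_distrib]
  refine Finset.prod_congr rfl fun i _ => ?_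
  rw [mrEdgeProj, one_add_neg_one_zpow_div_two]
  split_ifs <;> simp

open Classical in
theorem prod_mrCylProj_twisted {m : ℕ} {a : MRSector m} (ha : mrTwisted m a = true)
    {x : Fin 4 → MRCyl} (hx : ∀ i, (x i).right = (x (i + 1)).left)
    (ht : ∀ i, (x i).left.twisted = true) :
    ∏ i, mrCylProj m a i (x i)
      = if ∀ i, (x i).zero = mrCylZero i (x i).left (x (i + 1)).left then 1 else 0 := by
  have h1 (i : Fin 4) : mrCylProj m a i (x i)
      = if (x i).zero = mrCylZero i (x i).left (x (i + 1)).left then 1 else 0 := by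
    rw [mrCylProj, if_pos ha, one_add_neg_one_zpow_div_two, hx i]
    simp only [← even_mrCylParity_add_iff (ht i), mrCylParity]
    congr 2
    ring
  simp only [h1]
  rw [Finset.prod_ite_zero]
  simp

/-- Adding the four parity conditions around the torus, the winding differences telescope and every
fermion number occurs twice. The extra `1` of the last cylinder is what remains, so the constraint
in `mrZeroMode` holds automatically. -/
theorem odd_sum_zero {m : ℕ} {a : MRSector m} {x : Fin 4 → MRCyl}
    (ht : ∀ i, (x i).left.twisted = true)
    (hw : ∀ i, ∃ n : ℤ, (x i).left.winding = (n : ℚ) + mrCharge m a / (m : ℚ))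
    (hz : ∀ i, (x i).zero = mrCylZero i (x i).left (x (i + 1)).left) :
    Odd (∑ i, ((x i).zero : ℕ)) := by
  choose n hn using hw
  have h1 (i : Fin 4) : Even (n (i + 1) - n i + ((x i).left.fermion.card : ℤ)
      + ((x (i + 1)).left.fermion.card : ℤ) + (if i = 3 then 1 else 0)
      + (((x i).zero : ℕ) : ℤ)) := by
    have h := (even_mrCylParity_add_iff (ht i) (x i).zero).2 (hz i)
    rw [mrCylParity, hn i, hn (i + 1), add_sub_add_right_eq_sub, ← Int.cast_sub,
      Int.floor_intCast] at h
    exact h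
  have a0 := h1 0
  have a1 := h1 1
  have a2 := h1 2
  have a3 := h1 3
  simp only [Fin.isValue, zero_add, show (1 : Fin 4) + 1 = 2 from rfl,
    show (2 : Fin 4) + 1 = 3 from rfl, show (3 : Fin 4) + 1 = 0 from rfl,
    show (0 : Fin 4) ≠ 3 by decide, show (1 : Fin 4) ≠ 3 by decide,
    show (2 : Fin 4) ≠ 3 by decide, if_true, if_false] at a0 a1 a2 a3
  rw [Fin.sum_univ_four]
  obtain ⟨b0, a0⟩ := a0
  obtain ⟨b1, a1⟩ := a1
  obtain ⟨b2, a2⟩ := a2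
  obtain ⟨b3, a3⟩ := a3
  rw [Nat.odd_iff]
  omega

/-- In untwisted sectors the projections are absorbed into the interface weights. In twisted sectors
they fix every zero-mode occupation through `mrCylZero`, and the zero-mode amplitude is constant on
what is left, hence a mere coefficient. -/
theorem mrSectorState_eq {m : ℕ} (hm : 0 < m) {v w : ℝ} (hv : 0 < v) (hw : 0 < w) (L : ℝ)
    (hL : 0 < L) : mrSectorState m v w L = (mrTorus hm hv hw L hL).sectorState := by
  classical
  ext a x
  rw [mrSectorState, GluedTorus.sectorState]
  have h : (∀ i, x i = (mrTorus hm hv hw L hL).cyl i ((mrTorus hm hv hw L hL).left (x i))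
        ((mrTorus hm hv hw L hL).left (x (i + 1)))) ↔ (∀ i, (x i).right = (x (i + 1)).left) ∧
      ∀ i, (x i).zero = mrCylZero i (x i).left (x (i + 1)).left := by
    rw [← forall_and]
    refine forall_congr' fun i => ?_
    change x i = ⟨(x i).left, (x (i + 1)).left, mrCylZero i (x i).left (x (i + 1)).left⟩ ↔ _
    rcases x i with ⟨l, r, z⟩
    simp
  change _ = if _ then mrCoeff m a * ∏ i, mrEdgeWeight m v w L a (x i).left else 0
  by_cases hx : ∀ i, (x i).right = (x (i + 1)).left
  swap
  · rw [if_neg hx, if_neg fun h' => hx (h.1 h').1]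
  rw [if_pos hx]
  -- If an interface amplitude vanishes, both sides do. Otherwise all edges have the boundary
  -- condition and winding lattice of `a`, which the parity arguments need.
  by_cases hI : ∀ i, mrInterface m v w L a (x i).left ≠ 0
  swap
  · push Not at hI
    obtain ⟨i, hi⟩ := hI
    rw [Finset.prod_eq_zero (f := fun i => mrInterface m v w L a (x i).left)
      (Finset.mem_univ i) hi,
      Finset.prod_eq_zero (f := fun i => mrEdgeWeight m v w L a (x i).left)
      (Finset.mem_univ i) (by simp [mrEdgeWeight, hi])]
    simp
  have hI' (i) : (x i).left.twisted = mrTwisted m a ∧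
      ∃ n : ℤ, (x i).left.winding = (n : ℚ) + mrCharge m a / (m : ℚ) := by
    have := hI i
    simp only [mrInterface, ne_eq, ite_eq_right_iff, not_forall] at this
    exact this.1
  by_cases ha : mrTwisted m a = true
  · have ht (i) : (x i).left.twisted = true := (hI' i).1.trans ha
    have hW (i) : mrEdgeWeight m v w L a (x i).left = mrInterface m v w L a (x i).left := by
      simp [mrEdgeWeight, MREdgeEven, ha]
    rw [prod_mrCylProj_twisted ha hx ht]
    simp only [hW]
    by_cases hz : ∀ i, (x i).zero = mrCylZero i (x i).left (x (i + 1)).left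
    · rw [if_pos hz, if_pos (h.2 ⟨hx, hz⟩), mrCoeff, if_pos ha, mrZeroMode, if_pos ha,
        if_pos (odd_sum_zero ht (fun i => (hI' i).2) hz), one_mul, mul_comm]
    · rw [if_neg hz, if_neg fun h' => hz (h.1 h').2, zero_mul, zero_mul]
  · have ha' : mrTwisted m a = false := by simpa using ha
    have hz (i) : mrCylZero i (x i).left (x (i + 1)).left = 0 := by
      simp [mrCylZero, (hI' i).1, ha']
    rw [prod_mrCylProj_untwisted ha' hx, ← Finset.prod_mul_distrib]
    simp only [mrEdgeProj_mul_mrInterface ha']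
    rw [mrZeroMode, if_neg ha, mrCoeff, if_neg ha]
    simp only [hz] at h
    by_cases hz0 : ∀ i, (x i).zero = 0
    · rw [if_pos hz0, if_pos (h.2 ⟨hx, hz0⟩), mul_one, one_mul]
    · rw [if_neg hz0, if_neg fun h' => hz0 (h.1 h').2, mul_zero]

/-- The common scale is asymptotically the unprojected untwisted sum. Untwisted sectors keep half of
it by the parity projection. Twisted sectors have no projection at single edges but a fermion sum
smaller by `1/√2`, which is `1/2` times `√2`. -/
theorem tendsto_mrEdgeSum {m : ℕ} (hm : 0 < m) {v w : ℝ} (hv : 0 < v) (hw : 0 < w)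
    (a : MRSector m) :
    Tendsto (fun L : ℝ => mrEdgeSum m v w L a /
      (2 * halfWindingSum (v * Real.pi * m / 2 / L) 0 * fermionSum (w * Real.pi / L) (1 / 2) *
        bosonSum (v * Real.pi / L))) atTop (𝓝 (1 / 2 * mrDim m a)) := by
  have hπ := Real.pi_pos
  have hm' : (0 : ℝ) < m := by exact_mod_cast hm
  have ht := tendsto_const_div_nhdsGT_zero (c := v * Real.pi * m / 2) (by positivity)
  have hh := tendsto_const_div_nhdsGT_zero (c := w * Real.pi) (by positivity)
  have hW := (tendsto_windingSum_div ((mrCharge m a / m : ℚ) : ℝ)).comp ht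
  rcases a with a | r
  · have h1 := tendsto_evenSum_div ht hh ((mrCharge m (Sum.inl a) / m : ℚ) : ℝ)
      (s := 1 / 2) (by norm_num)
    have h2 := h1.mul hW
    rw [mul_one] at h2
    simp only [mrDim, mul_one]
    refine h2.congr' ?_
    filter_upwards [eventually_gt_atTop 0] with L hL
    have p1 := windingSum_pos (t := v * Real.pi * m / 2 / L) (by positivity)
      ((mrCharge m (Sum.inl a) / m : ℚ) : ℝ)
    have p2 := fermionSum_pos (h := w * Real.pi / L) (by positivity) (1 / 2)
    have p3 := bosonSum_pos (h := v * Real.pi / L) (by positivity)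
    have p4 := halfWindingSum_zero_pos (t := v * Real.pi * m / 2 / L) (by positivity)
    have hta : mrTwisted m (Sum.inl a) = false := rfl
    rw [mrEdgeSum, if_neg (by simp [hta]), Function.comp_apply]
    generalize windingSum _ _ = x1 at p1
    generalize fermionSum _ _ = x2 at p2
    generalize bosonSum _ = x3 at p3
    generalize halfWindingSum _ _ = x4 at p4
    field_simp
  · have h1 := tendsto_fermionSum_div.comp hh
    have h2 := hW.mul h1
    have e : (1 : ℝ) * (1 / Real.sqrt 2) = 1 / 2 * mrDim m (Sum.inr r) := by
      simp only [mrDim]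
      have := Real.mul_self_sqrt (zero_le_two (α := ℝ))
      field_simp
      linarith
    rw [e] at h2
    refine h2.congr' ?_
    filter_upwards [eventually_gt_atTop 0] with L hL
    have p3 := bosonSum_pos (h := v * Real.pi / L) (by positivity)
    rw [mrEdgeSum, if_pos (show mrTwisted m (Sum.inr r) = true from rfl),
      mul_div_mul_right _ _ p3.ne', Function.comp_apply,
      Function.comp_apply, div_mul_div_comm]

theorem mainTheorem4 (m : ℕ) (hm : 0 < m) :
    -- Laughlin states
    (∀ (v : ℝ) (_ : 0 < v) (ψ : Fin m → ℂ) (_ : ∑ a, ‖ψ a‖ ^ 2 = 1),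
      -- all entanglement negativities are finite
      (∀ L : ℝ, 0 < L → ∃ e₁ e₂ e₃ e₄ : ℝ,
        logNeg (rhoAB1CB2 (laughlinState m v L ψ)) = (e₁ : EReal) ∧
        logNeg (reduceAB (rhoAB1CB2 (laughlinState m v L ψ))) = (e₂ : EReal) ∧
        logNeg (rhoABCD (laughlinState m v L ψ)) = (e₃ : EReal) ∧
        logNeg (reduceAB (rhoABCD (laughlinState m v L ψ))) = (e₄ : EReal)) ∧
      -- the difference of negativities in the `A B₁ C B₂` geometry, as `L → ∞`
      Filter.Tendsto
        (fun L : ℝ => (logNeg (rhoAB1CB2 (laughlinState m v L ψ))).toReal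
          - (logNeg (reduceAB (rhoAB1CB2 (laughlinState m v L ψ)))).toReal)
        Filter.atTop
        (nhds (Real.log ((∑ a, ‖ψ a‖ * laughlinDim m a) ^ 2
          / ∑ a, ‖ψ a‖ ^ 2 * laughlinDim m a ^ 2))) ∧
      -- the disentangling condition there, as `L → ∞` and at every `L`
      (Filter.Tendsto
        (fun L : ℝ => (logNeg (rhoAB1CB2 (laughlinState m v L ψ))).toReal
          - (logNeg (reduceAB (rhoAB1CB2 (laughlinState m v L ψ)))).toReal)
        Filter.atTop (nhds 0) ↔ InSingleSector ψ) ∧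
      (∀ L : ℝ, 0 < L →
        (DisentanglingCondition (rhoAB1CB2 (laughlinState m v L ψ)) ↔ InSingleSector ψ)) ∧
      -- the `A B C D` geometry
      (∀ L : ℝ, 0 < L → DisentanglingCondition (rhoABCD (laughlinState m v L ψ)))) ∧
    -- Moore-Read states
    (∀ (v w : ℝ) (_ : 0 < v) (_ : 0 < w) (ψ : MRSector m → ℂ) (_ : ∑ a, ‖ψ a‖ ^ 2 = 1),
      (∀ L : ℝ, 0 < L → ∃ e₁ e₂ e₃ e₄ : ℝ,
        logNeg (rhoAB1CB2 (mrState m v w L ψ)) = (e₁ : EReal) ∧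
        logNeg (reduceAB (rhoAB1CB2 (mrState m v w L ψ))) = (e₂ : EReal) ∧
        logNeg (rhoABCD (mrState m v w L ψ)) = (e₃ : EReal) ∧
        logNeg (reduceAB (rhoABCD (mrState m v w L ψ))) = (e₄ : EReal)) ∧
      Filter.Tendsto
        (fun L : ℝ => (logNeg (rhoAB1CB2 (mrState m v w L ψ))).toReal
          - (logNeg (reduceAB (rhoAB1CB2 (mrState m v w L ψ)))).toReal)
        Filter.atTop
        (nhds (Real.log ((∑ a, ‖ψ a‖ * mrDim m a) ^ 2
          / ∑ a, ‖ψ a‖ ^ 2 * mrDim m a ^ 2))) ∧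
      (Filter.Tendsto
        (fun L : ℝ => (logNeg (rhoAB1CB2 (mrState m v w L ψ))).toReal
          - (logNeg (reduceAB (rhoAB1CB2 (mrState m v w L ψ)))).toReal)
        Filter.atTop (nhds 0) ↔ InSingleSector ψ) ∧
      (∀ L : ℝ, 0 < L →
        (DisentanglingCondition (rhoAB1CB2 (mrState m v w L ψ)) ↔ InSingleSector ψ)) ∧
      (∀ L : ℝ, 0 < L → DisentanglingCondition (rhoABCD (mrState m v w L ψ)))) := by
  have hπ := Real.pi_pos
  have hm' : (0 : ℝ) < m := by exact_mod_cast hm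
  refine ⟨fun v hv ψ hψ => ?_, fun v w hv hw ψ hψ => ?_⟩
  · refine negativity_of_scaling (laughlinSectorState m v) (laughlinTorus hm hv)
      (laughlinSectorState_eq hm hv) (fun L hL a e => ?_) _
      (fun L hL a => hasSum_laughlinInterface hm hv hL a) (laughlinDim m) (fun _ => one_pos)
      (fun L => 2 * halfWindingSum (v * Real.pi * m / 2 / L) 0 * bosonSum (v * Real.pi / L))
      (fun L hL => ?_) (c := 1) one_pos (fun a => ?_) ψ hψ
    · change ‖laughlinInterface m v L a e‖ ^ 2 = ‖laughlinInterface m v (L / 2) a e‖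
      rw [norm_laughlinInterface, norm_laughlinInterface]
      split_ifs
      · exact exp_neg_div_sq _ _
      · simp
    · exact mul_pos (mul_pos two_pos (halfWindingSum_zero_pos (by positivity)))
        (bosonSum_pos (by positivity))
    · rw [laughlinDim, mul_one]
      exact tendsto_laughlin hm hv _
  · refine negativity_of_scaling (mrSectorState m v w) (mrTorus hm hv hw)
      (mrSectorState_eq hm hv hw) (fun L hL a e => ?_) (mrEdgeSum m v w)
      (fun L hL a => hasSum_mrEdgeWeight hm hv hw hL a) (mrDim m) (fun a => ?_)
      (fun L => 2 * halfWindingSum (v * Real.pi * m / 2 / L) 0 *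
        fermionSum (w * Real.pi / L) (1 / 2) * bosonSum (v * Real.pi / L))
      (fun L hL => ?_) (c := 1 / 2) (by norm_num) (tendsto_mrEdgeSum hm hv hw) ψ hψ
    · change ‖mrEdgeWeight m v w L a e‖ ^ 2 = ‖mrEdgeWeight m v w (L / 2) a e‖
      rw [norm_mrEdgeWeight, norm_mrEdgeWeight]
      split_ifs
      · exact exp_neg_div_sq _ _
      · simp
    · rcases a with a | r
      · exact one_pos
      · exact Real.sqrt_pos.2 two_pos
    · exact mul_pos (mul_pos (mul_pos two_pos (halfWindingSum_zero_pos (by positivity)))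
        (fermionSum_pos (by positivity) _)) (bosonSum_pos (by positivity))

end
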